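/- **Setting.** Let $\Gamma=\mathbb Z^D$ with its graph distance, and attach to each site $x$ a finite-dimensional Hilbert space $\mathcal H_x$; for finite $\Lambda\subset\Gamma$ put $\mathcal H_\Lambda=\bigotimes_{x\in\Lambda}\mathcal H_x$ and $\mathcal A_\Lambda=\mathcal B(\mathcal H_\Lambda)$. A *Lindbladian* is a map $\mathcal L(\rho)=-i[H,\rho]+\sum_j\big(L_j\rho L_j^\dagger-\tfrac12\{L_j^\dagger L_j,\rho\}\big)$ with $H$ Hermitian and finitely many $L_j$. A superoperator $T$ of $\mathcal A_Z$ is regarded as the superoperator $T\otimes\mathrm{id}$ of $\mathcal A_\Lambda$ for $\Lambda\supset Z$. Write $\|\cdot\|_1$ for the trace norm and $\|T\|_\diamond=\sup_n\|T\otimes \mathrm{id}_n\|_{1\to1}$. Write $b_x(r)$ for the closed ball, $A(s)=\{y:\operatorname{dist}(y,A)\le s\}$ and $\partial_d\Lambda=\{x\in\Lambda:\operatorname{dist}(x,\Gamma\setminus\Lambda)\le d\}$. A *uniform family* $\mathcal L=(\mathcal M,\mathcal B)$ consists of a Lindbladian $\mathcal M_Z$ of $\mathcal A_Z$ for each finite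 $Z\subset\Gamma$, and, for each finite $\Lambda\subset\Gamma$, of a boundary condition: a convergent series $\mathcal B^{\partial\Lambda}=\sum_{d\ge1}\mathcal B^{\partial\Lambda}_d$, with $\mathcal B_d^{\partial\Lambda}$ supported on $\partial_d\Lambda$, such that $\mathcal B^{\partial\Lambda}$ and all its truncations $\sum_{d\le n}\mathcal B_d^{\partial\Lambda}$ are Lindbladians. Put $\mathcal L^{\bar\Lambda}=\sum_{Z\subset\Lambda}\mathcal M_Z+\mathcal B^{\partial\Lambda}$ and $T_t^{\bar\Lambda}=e^{t\mathcal L^{\bar\Lambda}}$. The family is *frustration free* if for every finite $\Lambda$ and every state $\rho_\infty$ that is a fixed point of the evolution $T_t^{\bar\Lambda}$ one has $\mathcal M_Z(\rho_\infty)=0$ for all $Z\subset\Lambda$. Say that the boundary conditions *decay around* a finite set $S\subset\Gamma$, with respect to $\nu,b,c$, if $$\nu(r)\sum_{d\ge \max(r,1)}\big\|\mathcal B_d^{\partial S(N)}\big\|_\diamond\le c\,N^b\qquad\text{for all integers } N\ge1,\ r\ge0 .$$ The family satisfies the *Lieb–Robinson assumptions* with $\nu,v,b,c$ if $v,b,c>0$,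 the function $\nu:\mathbb N\to(0,\infty)$ is non-decreasing with $\nu(r+s)\le\nu(r)\nu(s)$, $$\sup_{x\in\Gamma}\sum_{Z\ni x}\|\mathcal M_Z\|_\diamond\,|Z|\,\nu(\operatorname{diam}Z)\le v ,$$ and the boundary conditions decay around every one-point set $\{x\}$, i.e. on all balls $\{x\}(N)=b_x(N)$, with respect to $\nu,b,c$. **Statement.** Let $A\subset\Gamma$ be finite and let $v,b,c$ be real numbers. There is a polynomial $P$, depending only on $D$, $A$, $v$, $b$, $c$, with the following property. Let $\mathcal L=(\mathcal M,\mathcal B)$ be a frustration-free uniform family that satisfies the Lieb–Robinson assumptions with $\nu,v,b,c$, and whose boundary conditions decay around $A$ with respect to $\nu,b,c$. (If $A$ is a ball, the last condition follows from the Lieb–Robinson assumptions after enlarging $c$ by a factor that depends only on $b$ and the radius of $A$.) Let $m\ge1$ be an integer, $B=A(m+1)$, $R=A(m+1)\setminus A(m)$, let $\rho_\infty^m$ be a state on $A(m)$ that is a fixed point of $T_t^{\overline{A(m)}}$, and let $\tau$ be any state on $R$. Then for all $t\ge0$ $$\Big\|\big(T_t^{\bar B}-T_t^{\bar B\setminus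 A}\big)(\rho_\infty^m\otimes\tau)\Big\|_1\le P(m)\,\frac1{\nu(m)}\,\big[e^{vt}-1+t\big],$$ where $T_t^{\bar B\setminus A}$ is the evolution generated by $$\mathcal L^{\bar B\setminus A}=\sum_{Z\subset B\setminus A}\mathcal M_Z+\sum_{1\le d\le m+1}\mathcal B_d^{\partial B}.$$ -/

import Mathlib

open scoped ENNReal Matrix ComplexOrder

noncomputable section

namespace OpenLattice

/-! ### The lattice `ℤ^D` with its graph metric -/

/-- The sites of the cubic lattice `ℤ^D`. -/
abbrev Site (D : ℕ) : Type := Fin D → ℤ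

variable {D : ℕ}

/-- The graph distance of the cubic lattice. -/
def gdist (x y : Site D) : ℕ := ∑ i, (x i - y i).natAbs

/-- The diameter of a finite set of sites in the graph distance. -/
def gdiam (Z : Finset (Site D)) : ℕ := Z.sup fun x => Z.sup fun y => gdist x y

/-- The ball `b_x(r)`. -/
def ball (x : Site D) (r : ℕ) : Finset (Site D) :=
  (Fintype.piFinset fun i => Finset.Icc (x i - r) (x i + r)).filter fun y => gdist x y ≤ r

/-- The neighbourhood `A(s)`: the sites at distance at most `s` from `A`. -/
def nbhd (A : Finset (Site D)) (s : ℕ) : Finset (Site D) := A.biUnion fun x => ball x s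

open Classical in
/-- The inner boundary `∂_d Λ`: the sites of `Λ` at distance at most `d` from the complement. -/
def bdry (d : ℕ) (Λ : Finset (Site D)) : Finset (Site D) :=
  Λ.filter fun x => ∃ y, y ∉ Λ ∧ gdist x y ≤ d

theorem mem_ball {x y : Site D} {r : ℕ} : y ∈ ball x r ↔ gdist x y ≤ r := by
  simp only [ball, Finset.mem_filter, Fintype.mem_piFinset, Finset.mem_Icc, and_iff_right_iff_imp]
  intro h i
  have h1 : (x i - y i).natAbs ≤ gdist x y :=
    Finset.single_le_sum (f := fun i => (x i - y i).natAbs) (fun _ _ => Nat.zero_le _)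
      (Finset.mem_univ i)
  omega

theorem mem_nbhd {A : Finset (Site D)} {s : ℕ} {y : Site D} :
    y ∈ nbhd A s ↔ ∃ x ∈ A, gdist x y ≤ s := by
  simp [nbhd, mem_ball]

theorem nbhd_mono (A : Finset (Site D)) {s t : ℕ} (h : s ≤ t) : nbhd A s ⊆ nbhd A t := by
  intro y hy
  obtain ⟨x, hx, hxy⟩ := mem_nbhd.1 hy
  exact mem_nbhd.2 ⟨x, hx, hxy.trans h⟩

theorem exists_between (x y : Site D) (k : ℕ) :
    ∃ z, gdist x z ≤ k ∧ gdist z y ≤ gdist x y - k := by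
  induction k with
  | zero => exact ⟨x, by simp [gdist], by simp⟩
  | succ k ih =>
    obtain ⟨z, h1, h2⟩ := ih
    by_cases hz : z = y
    · exact ⟨z, h1.trans (Nat.le_succ k), by simp [hz, gdist]⟩
    obtain ⟨i, hi⟩ := Function.ne_iff.1 hz
    refine ⟨Function.update z i (z i + (y i - z i).sign), ?_, ?_⟩
    · rw [gdist, ← Finset.add_sum_erase _ _ (Finset.mem_univ i)] at h1 ⊢
      rw [Finset.sum_congr rfl (g := fun j => (x j - z j).natAbs) fun j hj => by
        rw [Function.update_of_ne (Finset.ne_of_mem_erase hj)], Function.update_self]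
      rcases lt_or_gt_of_ne hi with h | h
      · rw [Int.sign_eq_one_of_pos (by omega)]; omega
      · rw [Int.sign_eq_neg_one_of_neg (by omega)]; omega
    · rw [gdist, ← Finset.add_sum_erase _ _ (Finset.mem_univ i)] at h2 ⊢
      rw [Finset.sum_congr rfl (g := fun j => (z j - y j).natAbs) fun j hj => by
        rw [Function.update_of_ne (Finset.ne_of_mem_erase hj)], Function.update_self]
      rcases lt_or_gt_of_ne hi with h | h
      · rw [Int.sign_eq_one_of_pos (by omega)]; omega
      · rw [Int.sign_eq_neg_one_of_neg (by omega)]; omega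

theorem gdist_triangle (x y z : Site D) : gdist x z ≤ gdist x y + gdist y z := by
  rw [gdist, gdist, gdist, ← Finset.sum_add_distrib]
  exact Finset.sum_le_sum fun i _ => by omega

theorem nbhd_ball (x : Site D) (k s : ℕ) : nbhd (ball x k) s = nbhd {x} (k + s) := by
  ext y
  simp only [mem_nbhd, mem_ball, Finset.mem_singleton, exists_eq_left]
  constructor
  · rintro ⟨z, h1, h2⟩
    exact (gdist_triangle x z y).trans (add_le_add h1 h2)
  · intro h
    obtain ⟨z, h1, h2⟩ := exists_between x y k
    exact ⟨z, h1, by omega⟩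

theorem bdry_subset (d : ℕ) (Λ : Finset (Site D)) : bdry d Λ ⊆ Λ := by
  classical exact Finset.filter_subset _ _

/-! ### Matrices and superoperators -/

section Matrices

variable {I : Type*} [Fintype I] [DecidableEq I]

/-- The trace norm `tr |X|`: the sum of the singular values of `X`, that is, of the square roots
of the eigenvalues of `Xᴴ X`. -/
def traceNorm (X : Matrix I I ℂ) : ℝ :=
  ∑ i, √((Matrix.isHermitian_conjTranspose_mul_self X).eigenvalues i)

/-- The superoperator `T ⊗ id_n`, acting blockwise. -/
def ampliation (n : ℕ) (T : Module.End ℂ (Matrix I I ℂ)) :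
    Module.End ℂ (Matrix (I × Fin n) (I × Fin n) ℂ) where
  toFun X := Matrix.of fun p p' => T (Matrix.of fun i i' => X (i, p.2) (i', p'.2)) p.1 p'.1
  map_add' X Y := by
    ext p p'
    exact congrFun₂ (T.map_add (Matrix.of fun i i' => X (i, p.2) (i', p'.2))
      (Matrix.of fun i i' => Y (i, p.2) (i', p'.2))) p.1 p'.1
  map_smul' a X := by
    ext p p'
    exact congrFun₂ (T.map_smul a (Matrix.of fun i i' => X (i, p.2) (i', p'.2))) p.1 p'.1

/-- The norm of a superoperator induced by the trace norm. -/
def oneNorm (T : Module.End ℂ (Matrix I I ℂ)) : ℝ≥0∞ :=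
  ⨆ (X : Matrix I I ℂ) (_ : traceNorm X ≤ 1), ENNReal.ofReal (traceNorm (T X))

/-- The diamond norm. -/
def diamondNorm (T : Module.End ℂ (Matrix I I ℂ)) : ℝ≥0∞ :=
  ⨆ n : ℕ, oneNorm (ampliation n T)

/-- A Lindbladian: a superoperator of the Lindblad-Kossakowski form. -/
def IsLindbladian (T : Module.End ℂ (Matrix I I ℂ)) : Prop :=
  ∃ (H : Matrix I I ℂ) (k : ℕ) (L : Fin k → Matrix I I ℂ), H.IsHermitian ∧
    ∀ ρ, T ρ = -Complex.I • (H * ρ - ρ * H) +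
      ∑ j, (L j * ρ * (L j)ᴴ - (1 / 2 : ℂ) • ((L j)ᴴ * L j * ρ + ρ * ((L j)ᴴ * L j)))

/-- A state, given by its density matrix. -/
def IsState (ρ : Matrix I I ℂ) : Prop := ρ.PosSemidef ∧ ρ.trace = 1

/-- The evolution `exp (t T)` applied to `X`, as the (always convergent) exponential series. -/
def evolve (T : Module.End ℂ (Matrix I I ℂ)) (t : ℝ) (X : Matrix I I ℂ) : Matrix I I ℂ :=
  ∑' n : ℕ, ((t ^ n / n.factorial : ℝ) : ℂ) • (T ^ n) X

end Matrices

/-! ### Operators on finite regions -/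

/-- The canonical product basis of the Hilbert space of `Λ`; the site `x` has dimension `q x`. -/
abbrev Config (q : Site D → ℕ) (Λ : Finset (Site D)) : Type := (x : Λ) → Fin (q x)

/-- The algebra of operators of the region `Λ`. -/
abbrev Op (q : Site D → ℕ) (Λ : Finset (Site D)) : Type := Matrix (Config q Λ) (Config q Λ) ℂ

/-- Superoperators of the region `Λ`. -/
abbrev SuperOp (q : Site D → ℕ) (Λ : Finset (Site D)) : Type := Module.End ℂ (Op q Λ)

variable {q : Site D → ℕ} {Z Λ : Finset (Site D)}

/-- The restriction of a configuration to a smaller region. -/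
def restr (h : Z ⊆ Λ) (σ : Config q Λ) : Config q Z := fun x => σ ⟨x, h x.2⟩

/-- The configuration that equals `a` on `Z` and `σ` elsewhere. -/
def glue (a : Config q Z) (σ : Config q Λ) : Config q Λ :=
  fun x => if h : (x : Site D) ∈ Z then a ⟨x, h⟩ else σ x

/-- The superoperator `T ⊗ id` of `Λ`, where `T` is a superoperator of `Z ⊆ Λ`. -/
def extend (h : Z ⊆ Λ) (T : SuperOp q Z) : SuperOp q Λ where
  toFun X := Matrix.of fun σ σ' =>
    T (Matrix.of fun a a' => X (glue a σ) (glue a' σ')) (restr h σ) (restr h σ')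
  map_add' X Y := by
    ext σ σ'
    exact congrFun₂ (T.map_add (Matrix.of fun a a' => X (glue a σ) (glue a' σ'))
      (Matrix.of fun a a' => Y (glue a σ) (glue a' σ'))) (restr h σ) (restr h σ')
  map_smul' a X := by
    ext σ σ'
    exact congrFun₂ (T.map_smul a (Matrix.of fun a a' => X (glue a σ) (glue a' σ')))
      (restr h σ) (restr h σ')

/-- The product operator `ρ ⊗ τ` on `Λ`, for `ρ` on `Z ⊆ Λ` and `τ` on `Λ \ Z`. -/
def tensor (h : Z ⊆ Λ) (ρ : Op q Z) (τ : Op q (Λ \ Z)) : Op q Λ :=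
  Matrix.of fun σ σ' => ρ (restr h σ) (restr h σ') *
    τ (restr Finset.sdiff_subset σ) (restr Finset.sdiff_subset σ')

/-! ### Uniform families -/

/-- The terms `B_d`, `d ≥ 1`, of a boundary condition of `Λ`, with `B_d` a superoperator of
`∂_d Λ`; their sum converges. -/
structure BoundaryTerms (q : Site D → ℕ) (Λ : Finset (Site D)) where
  /-- The term `B_d`; the index `d = 0` is never used. -/
  term : (d : ℕ) → SuperOp q (bdry d Λ)
  summable : ∀ X : Op q Λ,
    Summable fun d : ℕ => extend (bdry_subset (d + 1) Λ) (term (d + 1)) X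

namespace BoundaryTerms

variable (B : BoundaryTerms q Λ)

/-- The truncation `∑_{1 ≤ d ≤ n} B_d`, as a superoperator of `Λ`. -/
def upTo (n : ℕ) : SuperOp q Λ :=
  ∑ d ∈ Finset.Icc 1 n, extend (bdry_subset d Λ) (B.term d)

/-- The sum `∑_{d ≥ 1} B_d`, as a superoperator of `Λ`. -/
def total : SuperOp q Λ where
  toFun X := ∑' d : ℕ, extend (bdry_subset (d + 1) Λ) (B.term (d + 1)) X
  map_add' X Y := by
    simp only [map_add]
    exact (B.summable X).tsum_add (B.summable Y)
  map_smul' a X := by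
    simp only [map_smul, RingHom.id_apply]
    exact (B.summable X).tsum_const_smul a

end BoundaryTerms

/-- A uniform family of Lindbladians: a bulk interaction `M` and boundary conditions
`B^{∂Λ} = ∑_{d ≥ 1} B_d`. Each boundary condition, and each of its truncations, is a
Lindbladian. -/
structure UniformFamily (q : Site D → ℕ) where
  /-- The bulk terms. -/
  M : (Z : Finset (Site D)) → SuperOp q Z
  /-- The boundary terms. -/
  B : (Λ : Finset (Site D)) → BoundaryTerms q Λ
  isLindbladian_M : ∀ Z, IsLindbladian (M Z)
  isLindbladian_B : ∀ Λ, IsLindbladian (B Λ).total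
  isLindbladian_upTo : ∀ Λ n, IsLindbladian ((B Λ).upTo n)

namespace UniformFamily

variable (F : UniformFamily q)

/-- The sum of the bulk terms inside `S`, as a superoperator of `Λ ⊇ S`. -/
def bulk {S Λ : Finset (Site D)} (h : S ⊆ Λ) : SuperOp q Λ :=
  ∑ Z : S.powerset, extend ((Finset.mem_powerset.1 Z.2).trans h) (F.M Z)

/-- The generator of the closed boundary evolution of `Λ`. -/
def closed (Λ : Finset (Site D)) : SuperOp q Λ :=
  F.bulk (Finset.Subset.refl Λ) + (F.B Λ).total

/-- The generator on `Λ` that keeps the bulk terms inside `Λ \ A` and the boundary terms of `Λ`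
up to depth `k`. -/
def removed (Λ A : Finset (Site D)) (k : ℕ) : SuperOp q Λ :=
  F.bulk (S := Λ \ A) Finset.sdiff_subset + (F.B Λ).upTo k

/-- A state that is a fixed point of the closed boundary evolution of `Λ`. -/
def IsFixedPoint (Λ : Finset (Site D)) (ρ : Op q Λ) : Prop :=
  IsState ρ ∧ ∀ t : ℝ, 0 ≤ t → evolve (F.closed Λ) t ρ = ρ

/-- Frustration freeness: all bulk terms inside `Λ` annihilate all fixed points of the closed
boundary evolution of `Λ`. -/
def FrustrationFree : Prop :=
  ∀ (Λ : Finset (Site D)) (ρ : Op q Λ), F.IsFixedPoint Λ ρ →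
    ∀ (Z : Finset (Site D)) (h : Z ⊆ Λ), extend h (F.M Z) ρ = 0

/-- The decay of the boundary conditions of the neighbourhoods of `A`:
`ν(r) ∑_{d ≥ r} ‖B_d^{∂A(N)}‖ ≤ c N^b` for all `r` and all `N ≥ 1`. -/
def BoundaryDecay (ν : ℕ → ℝ) (b c : ℝ) (A : Finset (Site D)) : Prop :=
  ∀ N : ℕ, 1 ≤ N → ∀ r : ℕ,
    ENNReal.ofReal (ν r) *
      ∑' d : {d : ℕ // 1 ≤ d ∧ r ≤ d}, diamondNorm ((F.B (nbhd A N)).term d) ≤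
    ENNReal.ofReal (c * (N : ℝ) ^ b)

/-- The Lieb-Robinson assumptions, with decay function `ν` and constants `v`, `b`, `c`. In the
last one, the neighbourhood `{x}(N)` is the ball `b_x(N)`. -/
structure LiebRobinson (ν : ℕ → ℝ) (v b c : ℝ) : Prop where
  v_pos : 0 < v
  b_pos : 0 < b
  c_pos : 0 < c
  ν_pos : ∀ r, 0 < ν r
  ν_mono : Monotone ν
  ν_mul : ∀ r s, ν (r + s) ≤ ν r * ν s
  bulk_decay : ∀ x : Site D,
    ∑' Z : {Z : Finset (Site D) // x ∈ Z},
      diamondNorm (F.M Z) * (Z.1.card : ℝ≥0∞) * ENNReal.ofReal (ν (gdiam Z.1)) ≤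
    ENNReal.ofReal v
  boundary_decay : ∀ x : Site D, F.BoundaryDecay ν b c {x}

variable {F}

/-- For a ball, the decay of the boundary conditions of its neighbourhoods is part of the
Lieb-Robinson assumptions, after an enlargement of the constant `c`. -/
theorem LiebRobinson.exists_ball {ν : ℕ → ℝ} {v b c : ℝ} (hF : F.LiebRobinson ν v b c)
    (x : Site D) (k : ℕ) :
    ∃ c' : ℝ, F.LiebRobinson ν v b c' ∧ F.BoundaryDecay ν b c' (ball x k) := by
  have h1 : (1 : ℝ) ≤ ((k : ℝ) + 1) ^ b := Real.one_le_rpow (by simp) hF.b_pos.le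
  refine ⟨c * ((k : ℝ) + 1) ^ b, ⟨hF.v_pos, hF.b_pos, by have := hF.c_pos; positivity, hF.ν_pos,
    hF.ν_mono, hF.ν_mul, hF.bulk_decay, fun y N hN r => ?_⟩, fun N hN r => ?_⟩
  · refine (hF.boundary_decay y N hN r).trans (ENNReal.ofReal_le_ofReal ?_)
    have := hF.c_pos
    gcongr
    exact le_mul_of_one_le_right this.le h1
  · have h2 := hF.boundary_decay x (k + N) (by omega) r
    rw [← nbhd_ball] at h2
    refine h2.trans (ENNReal.ofReal_le_ofReal ?_)
    have := hF.c_pos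
    have hN' : (1 : ℝ) ≤ N := by exact_mod_cast hN
    rw [mul_assoc, ← Real.mul_rpow (by positivity) (by positivity)]
    gcongr
    · exact hF.b_pos.le
    · push_cast
      nlinarith

end UniformFamily

end OpenLattice

end

open OpenLattice

/-!
Lindblad semigroups contract the trace norm, because an Euler step `1 + ε T` of the generator is,
up to order `ε²`, a sum of Kraus terms. Attach to each site of `B` its depth `m - dist(·, A)`, and
follow along the evolution the total size of the bulk terms at each site, weighted by `ν(depth)`.
Removing from the generator all the bulk terms that meet `Z`, and the boundary terms beyond the
smallest depth of a site of `Z`, which are small, leaves the generator of a contraction semigroup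
that commutes with `M_Z`. Duhamel's formula for this comparison bounds the weighted size of `M_Z` at
time `t` by its initial value and the time integral of the weighted sizes of the terms that meet
`Z`, so Grönwall's inequality yields growth at rate `v`. Initially frustration freeness annihilates
all the bulk terms inside `A(m)`, while a term that leaves `A(m)` has diameter at least its depth
and is controlled by the Lieb-Robinson sum. On `A` the weight is `ν(m)`, and a second application of
Duhamel's formula, which removes the bulk terms that meet `A`, gains the factor `ν(m)⁻¹`.
-/

noncomputable section

namespace OpenLattice

open Matrix (toEuclideanLin)

/-! ### The trace norm -/

theorem sum_norm_inner_mul_norm_inner_le {𝕜 E K : Type*} [RCLike 𝕜] [NormedAddCommGroup E]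
    [InnerProductSpace 𝕜 E] {u v : K → E} (hu : Orthonormal 𝕜 u) (hv : Orthonormal 𝕜 v)
    (s : Finset K) (a b : E) :
    ∑ k ∈ s, ‖inner 𝕜 (u k) a‖ * ‖inner 𝕜 b (v k)‖ ≤ ‖a‖ * ‖b‖ := by
  have bessel {w : K → E} (hw : Orthonormal 𝕜 w) (x : E) :
      √(∑ k ∈ s, ‖inner 𝕜 (w k) x‖ ^ 2) ≤ ‖x‖ :=
    Real.sqrt_le_iff.2 ⟨norm_nonneg x, hw.sum_inner_products_le x⟩
  simp only [norm_inner_symm b]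
  exact (Real.sum_mul_le_sqrt_mul_sqrt _ _ _).trans
    (mul_le_mul (bessel hu a) (bessel hv b) (Real.sqrt_nonneg _) (norm_nonneg a))

section TraceNorm

variable {I J K : Type*}

/-- The rank-one operator `|a⟩⟨b|`. -/
def ketBra (a b : EuclideanSpace ℂ I) : Matrix I I ℂ := Matrix.vecMulVec a (star b.ofLp)

theorem smul_ketBra (z : ℂ) (a b : EuclideanSpace ℂ I) : z • ketBra a b = ketBra (z • a) b :=
  (Matrix.smul_vecMulVec z _ _).symm

variable [Fintype I] [DecidableEq I]

theorem mul_ketBra_mul_conjTranspose (V W : Matrix I I ℂ)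
    (a b : EuclideanSpace ℂ I) :
    V * ketBra a b * Wᴴ = ketBra (toEuclideanLin V a) (toEuclideanLin W b) := by
  rw [ketBra, Matrix.mul_vecMulVec, Matrix.vecMulVec_mul, ← Matrix.star_mulVec]
  rfl

theorem toEuclideanLin_ketBra (a b v : EuclideanSpace ℂ I) :
    toEuclideanLin (ketBra a b) v = inner ℂ b v • a := by
  ext i
  simp [ketBra, Matrix.vecMulVec_mulVec, EuclideanSpace.inner_eq_star_dotProduct, dotProduct_comm,
    mul_comm]

theorem sum_ketBra_orthonormalBasis [Fintype K]
    (e : OrthonormalBasis K ℂ (EuclideanSpace ℂ I)) (X : Matrix I I ℂ) :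
    ∑ k, ketBra (toEuclideanLin X (e k)) (e k) = X := by
  refine toEuclideanLin.injective (LinearMap.ext fun v => ?_)
  simp only [map_sum, LinearMap.sum_apply, toEuclideanLin_ketBra, ← map_smul]
  rw [← map_sum, e.sum_repr']

theorem inner_toEuclideanLin_toEuclideanLin (X : Matrix I I ℂ) (a b : EuclideanSpace ℂ I) :
    inner ℂ (toEuclideanLin X a) (toEuclideanLin X b) = inner ℂ a (toEuclideanLin (Xᴴ * X) b) := by
  rw [← LinearMap.adjoint_inner_right, ← Matrix.toEuclideanLin_conjTranspose_eq_adjoint,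
    Matrix.toLpLin_mul_same]
  rfl

theorem inner_toEuclideanLin_eigenvectorBasis (X : Matrix I I ℂ) (i j : I) :
    letI h := Matrix.isHermitian_conjTranspose_mul_self X
    inner ℂ (toEuclideanLin X (h.eigenvectorBasis i)) (toEuclideanLin X (h.eigenvectorBasis j)) =
      if i = j then (h.eigenvalues j : ℂ) else 0 := by
  have h := Matrix.isHermitian_conjTranspose_mul_self X
  have eigen : toEuclideanLin (Xᴴ * X) (h.eigenvectorBasis j) =
      (h.eigenvalues j : ℂ) • h.eigenvectorBasis j :=
    congrArg (WithLp.toLp 2) (h.mulVec_eigenvectorBasis j)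
  rw [inner_toEuclideanLin_toEuclideanLin, eigen, inner_smul_right,
    h.eigenvectorBasis.inner_eq_ite, mul_ite, mul_one, mul_zero]

theorem traceNorm_eq_sum_norm (X : Matrix I I ℂ) :
    traceNorm X = ∑ i, ‖toEuclideanLin X
      ((Matrix.isHermitian_conjTranspose_mul_self X).eigenvectorBasis i)‖ := by
  refine Finset.sum_congr rfl fun i _ => ?_
  rw [@norm_eq_sqrt_re_inner ℂ, inner_toEuclideanLin_eigenvectorBasis, if_pos rfl]
  rfl

theorem exists_sum_ketBra_eq (X : Matrix I I ℂ) :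
    ∃ a b : I → EuclideanSpace ℂ I,
      ∑ i, ketBra (a i) (b i) = X ∧ ∑ i, ‖a i‖ * ‖b i‖ = traceNorm X :=
  ⟨_, _, sum_ketBra_orthonormalBasis
    (Matrix.isHermitian_conjTranspose_mul_self X).eigenvectorBasis X, by
    simp only [OrthonormalBasis.norm_eq_one, mul_one, traceNorm_eq_sum_norm]⟩

/-- The `u i` are the normalized images of the eigenvectors `v i` of `Xᴴ X` with `X v i ≠ 0`. -/
theorem exists_orthonormal_traceNorm_eq_sum_inner (X : Matrix I I ℂ) :
    ∃ (S : Finset I) (u v : S → EuclideanSpace ℂ I), Orthonormal ℂ u ∧ Orthonormal ℂ v ∧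
      (traceNorm X : ℂ) = ∑ i, inner ℂ (u i) (toEuclideanLin X (v i)) := by
  set e := (Matrix.isHermitian_conjTranspose_mul_self X).eigenvectorBasis
  set x : I → EuclideanSpace ℂ I := fun i => toEuclideanLin X (e i)
  set S : Finset I := {i | x i ≠ 0}
  have hS (i : S) : x i ≠ 0 := (Finset.mem_filter.1 i.2).2
  have orthogonal (i j : I) (hij : i ≠ j) : inner ℂ (x i) (x j) = 0 := by
    rw [inner_toEuclideanLin_eigenvectorBasis, if_neg hij]
  refine ⟨S, fun i => (‖x i‖ : ℂ)⁻¹ • x i, fun i => e i, ⟨fun i => ?_, fun i j hij => ?_⟩,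
    e.orthonormal.comp _ Subtype.val_injective, ?_⟩
  · simp [norm_smul, inv_mul_cancel₀ (norm_ne_zero_iff.2 (hS i))]
  · simp only [inner_smul_left, inner_smul_right, orthogonal i j (Subtype.coe_ne_coe.2 hij),
      mul_zero]
  · rw [traceNorm_eq_sum_norm, ← Finset.sum_filter_of_ne (p := fun i => x i ≠ 0)
      (fun i _ hi => norm_ne_zero_iff.1 hi), ← Finset.sum_coe_sort, Complex.ofReal_sum]
    refine Finset.sum_congr rfl fun i _ => ?_
    have hi : (‖x i‖ : ℂ) ≠ 0 := Complex.ofReal_ne_zero.2 (norm_ne_zero_iff.2 (hS i))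
    change (‖x i‖ : ℂ) = inner ℂ ((‖x i‖ : ℂ)⁻¹ • x i) (x i)
    rw [inner_smul_left, inner_self_eq_norm_sq_to_K, map_inv₀, Complex.conj_ofReal]
    change (‖x i‖ : ℂ) = (‖x i‖ : ℂ)⁻¹ * (‖x i‖ : ℂ) ^ 2
    field_simp

theorem traceNorm_nonneg (X : Matrix I I ℂ) : 0 ≤ traceNorm X :=
  Finset.sum_nonneg fun _ _ => Real.sqrt_nonneg _

/-- Together with `exists_sum_ketBra_eq` this exhibits the trace norm of `X` as the least value of
`∑ ‖a k‖ ‖b k‖` over all the ways to write `X = ∑ |a k⟩⟨b k|`. -/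
theorem traceNorm_sum_ketBra_le (s : Finset K) (a b : K → EuclideanSpace ℂ I) :
    traceNorm (∑ k ∈ s, ketBra (a k) (b k)) ≤ ∑ k ∈ s, ‖a k‖ * ‖b k‖ := by
  obtain ⟨S, u, v, hu, hv, hX⟩ :=
    exists_orthonormal_traceNorm_eq_sum_inner (∑ k ∈ s, ketBra (a k) (b k))
  calc
    _ = ‖(traceNorm (∑ k ∈ s, ketBra (a k) (b k)) : ℂ)‖ := by
      rw [Complex.norm_of_nonneg (traceNorm_nonneg _)]
    _ = ‖∑ k ∈ s, ∑ i, inner ℂ (u i) (a k) * inner ℂ (b k) (v i)‖ := by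
      rw [hX, Finset.sum_comm]
      simp only [map_sum, LinearMap.sum_apply, toEuclideanLin_ketBra, inner_sum, inner_smul_right,
        mul_comm]
    _ ≤ ∑ k ∈ s, ∑ i, ‖inner ℂ (u i) (a k)‖ * ‖inner ℂ (b k) (v i)‖ := by
      simp only [← norm_mul]
      exact norm_sum_le_of_le s fun k _ => norm_sum_le _ _
    _ ≤ ∑ k ∈ s, ‖a k‖ * ‖b k‖ :=
      Finset.sum_le_sum fun k _ => sum_norm_inner_mul_norm_inner_le hu hv _ _ _

theorem traceNorm_add_le (X Y : Matrix I I ℂ) : traceNorm (X + Y) ≤ traceNorm X + traceNorm Y := by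
  obtain ⟨a, b, hX, hnX⟩ := exists_sum_ketBra_eq X
  obtain ⟨a', b', hY, hnY⟩ := exists_sum_ketBra_eq Y
  simpa [hX, hY, hnX, hnY] using
    traceNorm_sum_ketBra_le Finset.univ (Sum.elim a a') (Sum.elim b b')

theorem traceNorm_smul_le (z : ℂ) (X : Matrix I I ℂ) : traceNorm (z • X) ≤ ‖z‖ * traceNorm X := by
  obtain ⟨a, b, hX, hnX⟩ := exists_sum_ketBra_eq X
  simpa [← smul_ketBra, ← Finset.smul_sum, hX, norm_smul, mul_assoc, ← Finset.mul_sum, hnX] using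
    traceNorm_sum_ketBra_le Finset.univ (fun i => z • a i) b

theorem traceNorm_zero : traceNorm (0 : Matrix I I ℂ) = 0 :=
  le_antisymm (by simpa using traceNorm_smul_le 0 (0 : Matrix I I ℂ)) (traceNorm_nonneg _)

theorem traceNorm_neg (X : Matrix I I ℂ) : traceNorm (-X) = traceNorm X :=
  le_antisymm (by simpa using traceNorm_smul_le (-1) X) (by simpa using traceNorm_smul_le (-1) (-X))

theorem eq_zero_of_traceNorm_eq_zero {X : Matrix I I ℂ} (h : traceNorm X = 0) : X = 0 := by
  obtain ⟨a, b, hX, hnX⟩ := exists_sum_ketBra_eq X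
  rw [h, Finset.sum_eq_zero_iff_of_nonneg fun _ _ => by positivity] at hnX
  rw [← hX]
  refine Finset.sum_eq_zero fun i hi => ?_
  rcases mul_eq_zero.1 (hnX i hi) with h | h <;> simp [ketBra, norm_eq_zero.1 h]

theorem traceNorm_submatrix_le [Fintype J] [DecidableEq J] (e : J ≃ I) (X : Matrix I I ℂ) :
    traceNorm (X.submatrix e e) ≤ traceNorm X := by
  obtain ⟨a, b, hX, hnX⟩ := exists_sum_ketBra_eq X
  let f := LinearIsometryEquiv.piLpCongrLeft 2 ℂ ℂ e.symm
  have submatrix_eq : ∑ i, ketBra (f (a i)) (f (b i)) = X.submatrix e e := by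
    rw [← hX]
    ext p q
    simp [f, ketBra, Matrix.sum_apply, Matrix.vecMulVec_apply]
  have := traceNorm_sum_ketBra_le Finset.univ (fun i => f (a i)) (fun i => f (b i))
  simpa only [submatrix_eq, LinearIsometryEquiv.norm_map, hnX] using this

theorem traceNorm_submatrix [Fintype J] [DecidableEq J] (e : J ≃ I) (X : Matrix I I ℂ) :
    traceNorm (X.submatrix e e) = traceNorm X :=
  le_antisymm (traceNorm_submatrix_le e X)
    (by simpa using traceNorm_submatrix_le e.symm (X.submatrix e e))

theorem traceNorm_le_re_trace {X : Matrix I I ℂ} (hX : X.PosSemidef) :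
    traceNorm X ≤ X.trace.re := by
  obtain ⟨n, v, rfl⟩ := Matrix.posSemidef_iff_eq_sum_vecMulVec.1 hX
  refine (traceNorm_sum_ketBra_le Finset.univ (fun k => WithLp.toLp 2 (v k))
    (fun k => WithLp.toLp 2 (v k))).trans_eq ?_
  simp only [Matrix.trace_sum, Matrix.trace_vecMulVec, Complex.re_sum, ← sq]
  refine Finset.sum_congr rfl fun k _ => ?_
  rw [@norm_sq_eq_re_inner ℂ, EuclideanSpace.inner_toLp_toLp]
  rfl

theorem traceNorm_sum_conj_le (s : Finset K) (V : K → Matrix I I ℂ) {C : ℝ} (hC : 0 ≤ C)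
    (hV : ∀ a, ∑ k ∈ s, ‖toEuclideanLin (V k) a‖ ^ 2 ≤ C * ‖a‖ ^ 2) (X : Matrix I I ℂ) :
    traceNorm (∑ k ∈ s, V k * X * (V k)ᴴ) ≤ C * traceNorm X := by
  obtain ⟨a, b, hX, hnX⟩ := exists_sum_ketBra_eq X
  have kraus : ∑ k ∈ s, V k * X * (V k)ᴴ = ∑ p ∈ s ×ˢ Finset.univ,
      ketBra (toEuclideanLin (V p.1) (a p.2)) (toEuclideanLin (V p.1) (b p.2)) := by
    simp only [Finset.sum_product, ← mul_ketBra_mul_conjTranspose, ← Finset.sum_mul,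
      ← Finset.mul_sum, hX]
  have sqrt_le (x : EuclideanSpace ℂ I) :
      √(∑ k ∈ s, ‖toEuclideanLin (V k) x‖ ^ 2) ≤ √C * ‖x‖ := by
    rw [← Real.sqrt_sq (norm_nonneg x), ← Real.sqrt_mul hC]
    exact Real.sqrt_le_sqrt (hV x)
  calc
    _ ≤ ∑ i, ∑ k ∈ s, ‖toEuclideanLin (V k) (a i)‖ * ‖toEuclideanLin (V k) (b i)‖ := by
      rw [kraus, ← Finset.sum_product_right']
      exact traceNorm_sum_ketBra_le _ _ _
    _ ≤ ∑ i, (√C * ‖a i‖) * (√C * ‖b i‖) := Finset.sum_le_sum fun i _ =>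
      (Real.sum_mul_le_sqrt_mul_sqrt _ _ _).trans
        (mul_le_mul (sqrt_le _) (sqrt_le _) (Real.sqrt_nonneg _) (by positivity))
    _ = C * traceNorm X := by
      simp only [mul_mul_mul_comm, Real.mul_self_sqrt hC, ← Finset.mul_sum, hnX]

end TraceNorm

/-! ### Contraction semigroups -/

section Semigroup

open NormedSpace Filter Topology

variable {E : Type*} [NormedAddCommGroup E] [NormedSpace ℝ E]

/-- A bounded operator that generates a semigroup of contractions. -/
def IsContractionGenerator (N : E →L[ℝ] E) : Prop := ∀ t : ℝ, 0 ≤ t → ‖exp (t • N)‖ ≤ 1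

theorem IsContractionGenerator.norm_exp_smul_apply_le {N : E →L[ℝ] E}
    (hN : IsContractionGenerator N) {t : ℝ} (ht : 0 ≤ t) (x : E) : ‖exp (t • N) x‖ ≤ ‖x‖ :=
  ((exp (t • N)).le_opNorm x).trans (mul_le_of_le_one_left (norm_nonneg x) (hN t ht))

variable [CompleteSpace E]

theorem eventually_norm_exp_smul_le {N : E →L[ℝ] E} {C : ℝ}
    (hN : ∀ ε : ℝ, 0 ≤ ε → ‖1 + ε • N‖ ≤ 1 + C * ε ^ 2) {η : ℝ} (hη : 0 < η) :
    ∀ᶠ u in 𝓝 (0 : ℝ), 0 ≤ u → ‖exp (u • N)‖ ≤ Real.exp (η * u) := by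
  have remainder := (hasDerivAt_exp_smul_const N (0 : ℝ)).isLittleO.bound (half_pos hη)
  have small : ∀ᶠ u in 𝓝 (0 : ℝ), C * u < η / 2 :=
    (by fun_prop : Continuous fun u : ℝ => C * u).continuousAt.eventually_lt_const
      (by simpa using hη)
  filter_upwards [remainder, small] with u hu hCu hu0
  simp only [zero_smul, exp_zero, one_mul, sub_zero, Real.norm_of_nonneg hu0] at hu
  calc
    ‖exp (u • N)‖ = ‖(exp (u • N) - 1 - u • N) + (1 + u • N)‖ := by congr 1; abel
    _ ≤ η / 2 * u + (1 + C * u ^ 2) := (norm_add_le _ _).trans (add_le_add hu (hN u hu0))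
    _ ≤ η * u + 1 := by nlinarith
    _ ≤ Real.exp (η * u) := Real.add_one_le_exp _

/-- The exponential is the limit of powers of Euler steps, whose errors add up to `O(t ε)`. -/
theorem isContractionGenerator_of_euler {N : E →L[ℝ] E} {C : ℝ}
    (hN : ∀ ε : ℝ, 0 ≤ ε → ‖1 + ε • N‖ ≤ 1 + C * ε ^ 2) : IsContractionGenerator N := by
  intro t ht
  have norm_le (η : ℝ) (hη : 0 < η) : ‖exp (t • N)‖ ≤ Real.exp (η * t) := by
    obtain ⟨n, hn, hn0⟩ := (((tendsto_const_div_atTop_nhds_zero_nat t).eventually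
      (eventually_norm_exp_smul_le hN hη)).and (eventually_gt_atTop 0)).exists
    have hn' : (n : ℝ) ≠ 0 := by exact_mod_cast hn0.ne'
    have power : exp (t • N) = exp ((t / n) • N) ^ n := by
      let := NormedAlgebra.restrictScalars ℚ ℝ (E →L[ℝ] E)
      rw [← exp_nsmul, ← Nat.cast_smul_eq_nsmul ℝ, smul_smul, mul_div_cancel₀ _ hn']
    calc
      ‖exp (t • N)‖ ≤ ‖exp ((t / n) • N)‖ ^ n := power ▸ norm_pow_le' _ hn0
      _ ≤ Real.exp (η * (t / n)) ^ n := by gcongr; exact hn (by positivity)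
      _ = Real.exp (η * t) := by rw [← Real.exp_nat_mul]; congr 1; field_simp
  have limit : Tendsto (fun η : ℝ => Real.exp (η * t)) (𝓝[>] 0) (𝓝 1) := by
    simpa using ((by fun_prop : Continuous fun η : ℝ => Real.exp (η * t)).tendsto 0).mono_left
      nhdsWithin_le_nhds
  exact ge_of_tendsto limit (by filter_upwards [self_mem_nhdsWithin] with η hη using norm_le η hη)

theorem hasDerivAt_exp_smul_apply (N : E →L[ℝ] E) (x : E) (t : ℝ) :
    HasDerivAt (fun s : ℝ => exp (s • N) x) (N (exp (t • N) x)) t := by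
  simpa using (hasDerivAt_exp_smul_const' N t).clm_apply (hasDerivAt_const t x)

theorem continuous_exp_smul_apply (N : E →L[ℝ] E) (x : E) :
    Continuous fun s : ℝ => exp (s • N) x :=
  continuous_iff_continuousAt.2 fun t => (hasDerivAt_exp_smul_apply N x t).continuousAt

theorem hasDerivAt_exp_sub_smul (N : E →L[ℝ] E) (t s : ℝ) :
    HasDerivAt (fun s : ℝ => exp ((t - s) • N)) (-(exp ((t - s) • N) * N)) s := by
  simpa [Function.comp_def] using
    (hasDerivAt_exp_smul_const N (t - s)).scomp s ((hasDerivAt_id s).const_sub t)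

theorem apply_exp_sub_exp_apply_eq_integral {A N : E →L[ℝ] E} (hAN : Commute A N)
    (L : E →L[ℝ] E) (x : E) (t : ℝ) :
    A (exp (t • L) x) - exp (t • N) (A x) =
      ∫ s in (0 : ℝ)..t, exp ((t - s) • N) (A ((L - N) (exp (s • L) x))) := by
  have deriv (s : ℝ) : HasDerivAt (fun s => exp ((t - s) • N) (A (exp (s • L) x)))
      (exp ((t - s) • N) (A ((L - N) (exp (s • L) x)))) s := by
    have product := (hasDerivAt_exp_sub_smul N t s).clm_apply
      ((hasDerivAt_const s A).clm_apply (hasDerivAt_exp_smul_apply L x s))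
    have comm (y : E) : A (N y) = N (A y) := DFunLike.congr_fun hAN.eq y
    convert product using 1
    simp only [zero_apply, zero_add, sub_apply, neg_apply, map_sub, comm]
    abel
  have cont : Continuous fun s => exp ((t - s) • N) (A ((L - N) (exp (s • L) x))) := by
    have exp_cont : Continuous fun s : ℝ => exp ((t - s) • N) :=
      continuous_iff_continuousAt.2 fun s => (hasDerivAt_exp_sub_smul N t s).continuousAt
    exact exp_cont.clm_apply ((A * (L - N)).continuous.comp (continuous_exp_smul_apply L x))
  rw [intervalIntegral.integral_eq_sub_of_hasDerivAt (fun s _ => deriv s)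
    (cont.intervalIntegrable _ _)]
  simp

theorem norm_apply_exp_sub_exp_apply_le {A N : E →L[ℝ] E} (hAN : Commute A N)
    (hN : IsContractionGenerator N) (L : E →L[ℝ] E) (x : E) {t : ℝ} (ht : 0 ≤ t) :
    ‖A (exp (t • L) x) - exp (t • N) (A x)‖ ≤
      ∫ s in (0 : ℝ)..t, ‖A ((L - N) (exp (s • L) x))‖ := by
  rw [apply_exp_sub_exp_apply_eq_integral hAN]
  refine intervalIntegral.norm_integral_le_of_norm_le ht (.of_forall fun s hs => ?_)
    (((A * (L - N)).continuous.comp (continuous_exp_smul_apply L x)).norm.intervalIntegrable _ _)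
  exact hN.norm_exp_smul_apply_le (sub_nonneg.2 hs.2) _

end Semigroup

theorem le_gronwallBound_of_le_integral {f : ℝ → ℝ} {δ K ε : ℝ} (hf : Continuous f) (hK : 0 ≤ K)
    (h : ∀ t, 0 ≤ t → f t ≤ δ + ∫ s in (0 : ℝ)..t, (K * f s + ε)) {t : ℝ} (ht : 0 ≤ t) :
    f t ≤ gronwallBound δ K ε t := by
  have deriv (s : ℝ) :
      HasDerivAt (fun r => δ + ∫ s in (0 : ℝ)..r, (K * f s + ε)) (K * f s + ε) s :=
    (intervalIntegral.integral_hasDerivAt_right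
      ((by fun_prop : Continuous fun s => K * f s + ε).intervalIntegrable _ _)
      (by fun_prop : Continuous fun s => K * f s + ε).stronglyMeasurable.stronglyMeasurableAtFilter
      (by fun_prop)).const_add δ
  refine (h t ht).trans ?_
  simpa using le_gronwallBound_of_liminf_deriv_right_le
    (fun s _ => (deriv s).continuousAt.continuousWithinAt)
    (fun s _ _ hr => (deriv s).hasDerivWithinAt.liminf_right_slope_le hr)
    (by simp : δ + ∫ s in (0 : ℝ)..0, (K * f s + ε) ≤ δ)
    (fun s hs => add_le_add_left (mul_le_mul_of_nonneg_left (h s hs.1) hK) ε) t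
    (Set.right_mem_Icc.2 ht)

/-! ### Superoperators on the trace class -/

section TraceClass

variable {I : Type*} [Fintype I] [DecidableEq I]

/-- The operators on the Hilbert space with basis `I`, as a Banach space for the trace norm. It is
a type synonym because the norm is not a global instance on matrices. -/
def TraceClass (I : Type*) : Type _ := Matrix I I ℂ

instance : AddCommGroup (TraceClass I) := inferInstanceAs (AddCommGroup (Matrix I I ℂ))

instance : Module ℂ (TraceClass I) := inferInstanceAs (Module ℂ (Matrix I I ℂ))

instance {I : Type*} [Finite I] : FiniteDimensional ℂ (TraceClass I) :=
  inferInstanceAs (FiniteDimensional ℂ (Matrix I I ℂ))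

instance : NormedAddCommGroup (TraceClass I) :=
  AddGroupNorm.toNormedAddCommGroup
    { toFun := fun X => traceNorm (I := I) X
      map_zero' := traceNorm_zero
      add_le' := traceNorm_add_le
      neg' := traceNorm_neg
      eq_zero_of_map_eq_zero' := fun _ => eq_zero_of_traceNorm_eq_zero }

instance : NormedSpace ℂ (TraceClass I) where
  norm_smul_le := traceNorm_smul_le (I := I)

instance : CompleteSpace (TraceClass I) := FiniteDimensional.complete ℂ _

/-- The identity map from matrices to the trace class. -/
def toTraceClass : Matrix I I ℂ ≃ₗ[ℂ] TraceClass I := LinearEquiv.refl ℂ (Matrix I I ℂ)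

theorem norm_toTraceClass (X : Matrix I I ℂ) : ‖toTraceClass X‖ = traceNorm X := rfl

/-- A superoperator, as a bounded operator on the trace class. Scalars are restricted to `ℝ` because
the time parameter of the semigroups is real. -/
def superCLM : Module.End ℂ (Matrix I I ℂ) →ₐ[ℝ] TraceClass I →L[ℝ] TraceClass I :=
  AlgHom.ofLinearMap
    { toFun := fun T => (LinearMap.toContinuousLinearMap (E := TraceClass I) (F' := TraceClass I)
        (toTraceClass.conj T)).restrictScalars ℝ
      map_add' := fun _ _ => rfl
      map_smul' := fun _ _ => rfl }
    rfl fun _ _ => rfl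

theorem superCLM_toTraceClass (T : Module.End ℂ (Matrix I I ℂ)) (X : Matrix I I ℂ) :
    superCLM T (toTraceClass X) = toTraceClass (T X) := rfl

theorem norm_superCLM_le {T : Module.End ℂ (Matrix I I ℂ)} {C : ℝ} (hC : 0 ≤ C)
    (h : ∀ X, traceNorm (T X) ≤ C * traceNorm X) : ‖superCLM T‖ ≤ C :=
  ContinuousLinearMap.opNorm_le_bound _ hC h

theorem toTraceClass_evolve (T : Module.End ℂ (Matrix I I ℂ)) (t : ℝ) (X : Matrix I I ℂ) :
    toTraceClass (evolve T t X) = NormedSpace.exp (t • superCLM T) (toTraceClass X) := by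
  have series := (ContinuousLinearMap.apply ℝ (TraceClass I) (toTraceClass X)).hasSum
    (NormedSpace.exp_series_hasSum_exp' (𝕂 := ℝ) (t • superCLM T))
  refine (toTraceClass.toContinuousLinearEquiv.map_tsum).trans (Eq.trans ?_ series.tsum_eq)
  refine tsum_congr fun n => ?_
  rw [smul_pow, ← map_pow, smul_smul, ← div_eq_inv_mul]
  rfl

theorem traceNorm_apply_le {T : Module.End ℂ (Matrix I I ℂ)} (hT : oneNorm T ≠ ∞)
    (X : Matrix I I ℂ) : traceNorm (T X) ≤ (oneNorm T).toReal * traceNorm X := by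
  obtain h | h := (traceNorm_nonneg X).eq_or_lt
  · rw [eq_zero_of_traceNorm_eq_zero h.symm, map_zero, traceNorm_zero, mul_zero]
  set r : ℂ := Complex.ofReal (traceNorm X)
  have norm_r : ‖r‖ = traceNorm X := Complex.norm_of_nonneg h.le
  have normalized : traceNorm (r⁻¹ • X) ≤ 1 := (traceNorm_smul_le _ _).trans_eq <| by
    rw [norm_inv, norm_r, inv_mul_cancel₀ h.ne']
  calc
    traceNorm (T X) = traceNorm (r • T (r⁻¹ • X)) := by
      rw [← map_smul, smul_inv_smul₀ (norm_pos_iff.1 (norm_r ▸ h))]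
    _ ≤ traceNorm X * traceNorm (T (r⁻¹ • X)) := norm_r ▸ traceNorm_smul_le _ _
    _ ≤ traceNorm X * (oneNorm T).toReal := by
      gcongr
      exact (ENNReal.ofReal_le_iff_le_toReal hT).1
        (le_iSup₂ (f := fun (Y : Matrix I I ℂ) (_ : traceNorm Y ≤ 1) =>
          ENNReal.ofReal (traceNorm (T Y))) _ normalized)
    _ = (oneNorm T).toReal * traceNorm X := mul_comm _ _

end TraceClass

/-! ### Lindbladians -/

section Lindbladian

variable {I J : Type*} [Fintype I] [Fintype J]

namespace IsLindbladian

theorem zero : IsLindbladian (0 : Module.End ℂ (Matrix I I ℂ)) :=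
  ⟨0, 0, Fin.elim0, Matrix.isHermitian_zero, fun ρ => by simp⟩

theorem add {S T : Module.End ℂ (Matrix I I ℂ)} (hS : IsLindbladian S)
    (hT : IsLindbladian T) : IsLindbladian (S + T) := by
  obtain ⟨H, k, L, hH, hS⟩ := hS
  obtain ⟨H', k', L', hH', hT⟩ := hT
  refine ⟨H + H', k + k', Fin.append L L', hH.add hH', fun ρ => ?_⟩
  rw [LinearMap.add_apply, hS, hT, Fin.sum_univ_add]
  simp only [Fin.append_left, Fin.append_right, add_mul, mul_add]
  module

theorem sum {K : Type*} {s : Finset K} {T : K → Module.End ℂ (Matrix I I ℂ)}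
    (h : ∀ k ∈ s, IsLindbladian (T k)) : IsLindbladian (∑ k ∈ s, T k) :=
  Finset.sum_induction _ _ (fun _ _ => add) zero h

/-- Here `G = -i H - 1/2 ∑ Lᴴ L`. -/
theorem exists_eq_mul_add_mul_add_sum {T : Module.End ℂ (Matrix I I ℂ)} (hT : IsLindbladian T) :
    ∃ (G : Matrix I I ℂ) (k : ℕ) (L : Fin k → Matrix I I ℂ),
      G + Gᴴ + ∑ j, (L j)ᴴ * L j = 0 ∧
        ∀ X, T X = G * X + X * Gᴴ + ∑ j, L j * X * (L j)ᴴ := by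
  obtain ⟨H, k, L, hH, hT⟩ := hT
  set S : Matrix I I ℂ := ∑ j, (L j)ᴴ * L j with hS
  have adjoint : (-Complex.I • H - (1 / 2 : ℂ) • S)ᴴ = Complex.I • H - (1 / 2 : ℂ) • S := by
    simp [hS, Matrix.conjTranspose_sum, hH.eq]
  refine ⟨-Complex.I • H - (1 / 2 : ℂ) • S, k, L, by rw [adjoint]; module, fun X => ?_⟩
  rw [hT, adjoint, Finset.sum_sub_distrib, ← Finset.smul_sum, Finset.sum_add_distrib,
    ← Finset.sum_mul, ← Finset.mul_sum]
  simp only [sub_mul, mul_sub, smul_mul_assoc, mul_smul_comm]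
  module

end IsLindbladian

variable [DecidableEq I]

/-- The Kraus operators `1 + ε G` and `√ε L j` which, up to a term of order `ε²`, implement the
Euler step `X ↦ X + ε T X` of the superoperator `T X = G X + X Gᴴ + ∑ L j X (L j)ᴴ`. -/
def eulerKraus {k : ℕ} (G : Matrix I I ℂ) (L : Fin k → Matrix I I ℂ) (ε : ℝ) :
    Option (Fin k) → Matrix I I ℂ :=
  fun o => o.elim (1 + ε • G) fun j => √ε • L j

section EulerKraus

variable {k : ℕ} (G : Matrix I I ℂ) (L : Fin k → Matrix I I ℂ) {ε : ℝ}

theorem sum_eulerKraus_conj (hε : 0 ≤ ε) (X : Matrix I I ℂ) :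
    ∑ o, eulerKraus G L ε o * X * (eulerKraus G L ε o)ᴴ =
      X + ε • (G * X + X * Gᴴ + ∑ j, L j * X * (L j)ᴴ) + ε ^ 2 • (G * X * Gᴴ) := by
  simp only [Fintype.sum_option, eulerKraus, Option.elim, Matrix.conjTranspose_add,
    Matrix.conjTranspose_smul, Matrix.conjTranspose_one, star_trivial, add_mul, mul_add, one_mul,
    mul_one, smul_mul_assoc, mul_smul_comm, smul_smul, Real.mul_self_sqrt hε, ← Finset.smul_sum]
  module

theorem sum_conjTranspose_eulerKraus_mul_self (hε : 0 ≤ ε)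
    (hG : G + Gᴴ + ∑ j, (L j)ᴴ * L j = 0) :
    ∑ o, (eulerKraus G L ε o)ᴴ * eulerKraus G L ε o = 1 + ε ^ 2 • (Gᴴ * G) := by
  simp only [Fintype.sum_option, eulerKraus, Option.elim, Matrix.conjTranspose_add,
    Matrix.conjTranspose_smul, Matrix.conjTranspose_one, star_trivial, add_mul, mul_add, one_mul,
    mul_one, smul_mul_assoc, mul_smul_comm, smul_smul, Real.mul_self_sqrt hε, ← Finset.smul_sum,
    eq_neg_of_add_eq_zero_right hG]
  module

theorem sum_norm_sq_eulerKraus (hε : 0 ≤ ε) (hG : G + Gᴴ + ∑ j, (L j)ᴴ * L j = 0)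
    (a : EuclideanSpace ℂ I) :
    ∑ o, ‖toEuclideanLin (eulerKraus G L ε o) a‖ ^ 2 =
      ‖a‖ ^ 2 + ε ^ 2 * ‖toEuclideanLin G a‖ ^ 2 := by
  simp only [@norm_sq_eq_re_inner ℂ, inner_toEuclideanLin_toEuclideanLin]
  rw [← map_sum, ← inner_sum, ← LinearMap.sum_apply, ← map_sum,
    sum_conjTranspose_eulerKraus_mul_self G L hε hG, map_add, Matrix.toLpLin_one,
    LinearMap.add_apply, inner_add_right, map_add, ← Complex.coe_smul, map_smul,
    LinearMap.smul_apply, inner_smul_right]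
  simp [-Complex.ofReal_pow]

end EulerKraus

theorem IsLindbladian.isContractionGenerator {T : Module.End ℂ (Matrix I I ℂ)}
    (hT : IsLindbladian T) : IsContractionGenerator (superCLM T) := by
  obtain ⟨G, k, L, hG, hT⟩ := hT.exists_eq_mul_add_mul_add_sum
  set C : ℝ := ‖LinearMap.toContinuousLinearMap (toEuclideanLin G)‖ ^ 2
  have norm_G_le (a : EuclideanSpace ℂ I) : ‖toEuclideanLin G a‖ ^ 2 ≤ C * ‖a‖ ^ 2 := by
    rw [← mul_pow]
    gcongr
    exact (LinearMap.toContinuousLinearMap (toEuclideanLin G)).le_opNorm a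
  refine isContractionGenerator_of_euler (C := 2 * C) fun ε hε => ?_
  have : 1 + ε • superCLM T = superCLM (1 + ε • T) := by rw [map_add, map_one, map_smul]
  rw [this]
  refine norm_superCLM_le (by positivity) fun X => ?_
  have kraus_le := traceNorm_sum_conj_le Finset.univ (eulerKraus G L ε)
    (by positivity : 0 ≤ 1 + C * ε ^ 2)
    (fun a => by nlinarith [sum_norm_sq_eulerKraus G L hε hG a, norm_G_le a, sq_nonneg ε]) X
  have conj_le : traceNorm (G * X * Gᴴ) ≤ C * traceNorm X := by
    simpa using traceNorm_sum_conj_le {()} (fun _ => G) (by positivity) (by simpa using norm_G_le) X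
  calc
    traceNorm ((1 + ε • T) X)
      = traceNorm (∑ o, eulerKraus G L ε o * X * (eulerKraus G L ε o)ᴴ +
          (-(ε ^ 2 : ℝ) : ℂ) • (G * X * Gᴴ)) := by
      rw [sum_eulerKraus_conj G L hε, ← hT, ← Complex.ofReal_neg, Complex.coe_smul]
      congr 1
      change X + ε • T X = _
      module
    _ ≤ (1 + C * ε ^ 2) * traceNorm X + ε ^ 2 * (C * traceNorm X) := by
      refine (traceNorm_add_le _ _).trans (add_le_add kraus_le ((traceNorm_smul_le _ _).trans ?_))
      rw [norm_neg, Complex.norm_of_nonneg (by positivity)]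
      gcongr
    _ = (1 + 2 * C * ε ^ 2) * traceNorm X := by ring

end Lindbladian

/-! ### Ampliation and reindexing -/

section Ampliation

open scoped Kronecker

variable {I J K : Type*}

/-- The superoperator `T`, transported along a bijection of the basis. -/
def reindex (e : I ≃ J) (T : Module.End ℂ (Matrix I I ℂ)) : Module.End ℂ (Matrix J J ℂ) :=
  (Matrix.reindexLinearEquiv ℂ ℂ e e).conj T

theorem reindex_apply (e : I ≃ J) (T : Module.End ℂ (Matrix I I ℂ)) (X : Matrix J J ℂ) :
    reindex e T X = (T (X.submatrix e e)).submatrix e.symm e.symm := rfl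

variable [Fintype I] [Fintype J] [Fintype K] [DecidableEq K]

theorem submatrix_kronecker_one_mul (A : Matrix I I ℂ) (X : Matrix (I × K) (I × K) ℂ) (k l : K) :
    ((A ⊗ₖ (1 : Matrix K K ℂ)) * X).submatrix (·, k) (·, l) = A * X.submatrix (·, k) (·, l) := by
  ext i j
  simp [Matrix.mul_apply, Fintype.sum_prod_type, Matrix.one_apply]

theorem submatrix_mul_kronecker_one (A : Matrix I I ℂ) (X : Matrix (I × K) (I × K) ℂ) (k l : K) :
    (X * (A ⊗ₖ (1 : Matrix K K ℂ))).submatrix (·, k) (·, l) = X.submatrix (·, k) (·, l) * A := by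
  ext i j
  simp [Matrix.mul_apply, Fintype.sum_prod_type, Matrix.one_apply]

theorem IsLindbladian.ampliation (n : ℕ) {T : Module.End ℂ (Matrix I I ℂ)} (hT : IsLindbladian T) :
    IsLindbladian (ampliation n T) := by
  obtain ⟨H, k, L, hH, hT⟩ := hT
  have conjTranspose_kronecker_one (A : Matrix I I ℂ) :
      (A ⊗ₖ (1 : Matrix (Fin n) (Fin n) ℂ))ᴴ = Aᴴ ⊗ₖ 1 := by
    rw [Matrix.conjTranspose_kronecker, Matrix.conjTranspose_one]
  refine ⟨H ⊗ₖ 1, k, fun j => L j ⊗ₖ 1, (conjTranspose_kronecker_one H).trans (by rw [hH.eq]),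
    fun X => ?_⟩
  have block (Y Z : Matrix (I × Fin n) (I × Fin n) ℂ) (p p' : I × Fin n) :
      (Y * Z) p p' = (Y * Z).submatrix (·, p.2) (·, p'.2) p.1 p'.1 := rfl
  ext p p'
  refine (congrFun₂ (hT (X.submatrix (·, p.2) (·, p'.2))) p.1 p'.1).trans ?_
  simp only [Matrix.add_apply, Matrix.sub_apply, Matrix.smul_apply, Matrix.sum_apply,
    conjTranspose_kronecker_one, ← Matrix.mul_kronecker_mul, one_mul]
  simp only [block _ _ p p', submatrix_kronecker_one_mul, submatrix_mul_kronecker_one]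

theorem IsLindbladian.reindex (e : I ≃ J) {T : Module.End ℂ (Matrix I I ℂ)}
    (hT : IsLindbladian T) : IsLindbladian (reindex e T) := by
  obtain ⟨H, k, L, hH, hT⟩ := hT
  refine ⟨H.submatrix e.symm e.symm, k, fun j => (L j).submatrix e.symm e.symm,
    hH.submatrix e.symm, fun X => ?_⟩
  obtain ⟨Y, rfl⟩ : ∃ Y : Matrix I I ℂ, X = Y.submatrix e.symm e.symm :=
    ⟨X.submatrix e e, by simp⟩
  simp only [reindex_apply, Matrix.submatrix_submatrix, Equiv.symm_comp_self,
    Matrix.submatrix_id_id, hT, Matrix.conjTranspose_submatrix, Matrix.submatrix_mul_equiv]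
  ext p p'
  simp only [Matrix.submatrix_apply, Matrix.add_apply, Matrix.sub_apply, Matrix.smul_apply,
    Matrix.sum_apply]

variable [DecidableEq I] [DecidableEq J]

theorem traceNorm_reindex_ampliation_le {n : ℕ} (e : I × Fin n ≃ J)
    {T : Module.End ℂ (Matrix I I ℂ)} (hT : diamondNorm T ≠ ∞) (X : Matrix J J ℂ) :
    traceNorm (reindex e (ampliation n T) X) ≤ (diamondNorm T).toReal * traceNorm X := by
  have oneNorm_le : oneNorm (ampliation n T) ≤ diamondNorm T :=
    le_iSup (fun n => oneNorm (ampliation n T)) n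
  rw [reindex_apply, traceNorm_submatrix e.symm, ← traceNorm_submatrix e X]
  refine (traceNorm_apply_le (ne_top_of_le_ne_top hT oneNorm_le) _).trans ?_
  gcongr
  exact traceNorm_nonneg _

end Ampliation

/-! ### Superoperators of regions -/

section Regions

variable {D : ℕ} {q : Site D → ℕ} {Y Z Λ : Finset (Site D)}

/-- A configuration of `Λ`, as a pair of configurations of `Z ⊆ Λ` and of `Λ \ Z`. -/
def splitConfig (h : Z ⊆ Λ) : Config q Λ ≃ Config q Z × Config q (Λ \ Z) where
  toFun σ := (restr h σ, restr Finset.sdiff_subset σ)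
  invFun p x := if hx : (x : Site D) ∈ Z then p.1 ⟨x, hx⟩
    else p.2 ⟨x, Finset.mem_sdiff.2 ⟨x.2, hx⟩⟩
  left_inv σ := by
    ext x
    by_cases hx : (x : Site D) ∈ Z <;> simp [hx, restr]
  right_inv p := by
    refine Prod.ext (funext fun x => ?_) (funext fun x => ?_)
    · simp [restr]
    · simp [restr, (Finset.mem_sdiff.1 x.2).2]

theorem restr_glue_of_disjoint (h : Z ⊆ Λ) (hd : Disjoint Y Z) (a : Config q Y)
    (σ : Config q Λ) : restr h (glue a σ) = restr h σ := by
  funext x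
  simp [restr, glue, Finset.disjoint_right.1 hd x.2]

theorem restr_glue (h : Y ⊆ Λ) (a : Config q Z) (σ : Config q Λ) :
    restr h (glue a σ) = glue a (restr h σ) := rfl

theorem glue_glue_of_disjoint (hd : Disjoint Y Z) (a : Config q Y) (b : Config q Z)
    (σ : Config q Λ) : glue a (glue b σ) = glue b (glue a σ) := by
  funext x
  by_cases hx : (x : Site D) ∈ Y
  · simp [glue, hx, Finset.disjoint_left.1 hd hx]
  · simp [glue, hx]

theorem exists_extend_eq_reindex_ampliation (h : Z ⊆ Λ) :
    ∃ (n : ℕ) (e : Config q Z × Fin n ≃ Config q Λ),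
      ∀ T : SuperOp q Z, extend h T = reindex e (ampliation n T) := by
  let f := Fintype.equivFin (Config q (Λ \ Z))
  let e := ((splitConfig h).trans (Equiv.prodCongr (Equiv.refl _) f)).symm
  have glue_eq (a : Config q Z) (σ : Config q Λ) : e (a, (e.symm σ).2) = glue a σ := by
    change (splitConfig h).symm (a, f.symm (f (splitConfig h σ).2)) = _
    rw [f.symm_apply_apply]
    rfl
  refine ⟨_, e, fun T => LinearMap.ext fun X => ?_⟩
  ext σ σ'
  simp only [extend, ← glue_eq]
  rfl

theorem IsLindbladian.extend (h : Z ⊆ Λ) {T : SuperOp q Z} (hT : IsLindbladian T) :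
    IsLindbladian (extend h T) := by
  obtain ⟨n, e, he⟩ := exists_extend_eq_reindex_ampliation (q := q) h
  exact he T ▸ (hT.ampliation n).reindex e

theorem traceNorm_extend_le (h : Z ⊆ Λ) {T : SuperOp q Z} (hT : diamondNorm T ≠ ∞) (X : Op q Λ) :
    traceNorm (extend h T X) ≤ (diamondNorm T).toReal * traceNorm X := by
  obtain ⟨n, e, he⟩ := exists_extend_eq_reindex_ampliation (q := q) h
  exact he T ▸ traceNorm_reindex_ampliation_le e hT X

theorem extend_apply (h : Z ⊆ Λ) (T : SuperOp q Z) (X : Op q Λ) (σ σ' : Config q Λ) :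
    extend h T X σ σ' = ∑ a : Config q Z × Config q Z, X (glue a.1 σ) (glue a.2 σ') *
      T (Matrix.single a.1 a.2 1) (restr h σ) (restr h σ') := by
  change T (Matrix.of fun a a' => X (glue a σ) (glue a' σ')) (restr h σ) (restr h σ') = _
  conv_lhs => rw [Matrix.matrix_eq_sum_single (Matrix.of fun a a' => X (glue a σ) (glue a' σ'))]
  simp only [map_sum, Matrix.sum_apply, ← Fintype.sum_prod_type']
  refine Finset.sum_congr rfl fun a _ => ?_
  rw [Matrix.of_apply, ← mul_one (X _ _), ← smul_eq_mul, ← Matrix.smul_single, map_smul,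
    Matrix.smul_apply, smul_eq_mul, smul_eq_mul, mul_one]

theorem extend_commute (hY : Y ⊆ Λ) (hZ : Z ⊆ Λ) (hd : Disjoint Y Z) (S : SuperOp q Y)
    (T : SuperOp q Z) : Commute (extend hY S) (extend hZ T) := by
  refine LinearMap.ext fun X => ?_
  ext σ σ'
  simp only [Module.End.mul_apply, extend_apply, restr_glue_of_disjoint hZ hd,
    restr_glue_of_disjoint hY hd.symm, Finset.sum_mul]
  rw [Finset.sum_comm]
  refine Finset.sum_congr rfl fun b _ => Finset.sum_congr rfl fun a _ => ?_
  rw [glue_glue_of_disjoint hd, glue_glue_of_disjoint hd, mul_right_comm]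

theorem extend_tensor (h : Y ⊆ Λ) (hZ : Z ⊆ Y) (T : SuperOp q Z) (ρ : Op q Y)
    (τ : Op q (Λ \ Y)) :
    extend (hZ.trans h) T (tensor h ρ τ) = tensor h (extend hZ T ρ) τ := by
  ext σ σ'
  have hd : Disjoint Z (Λ \ Y) := Finset.disjoint_of_subset_left hZ Finset.disjoint_sdiff
  simp only [tensor, Matrix.of_apply, extend_apply, restr_glue h, restr_glue_of_disjoint _ hd,
    Finset.sum_mul, mul_right_comm]
  rfl

open scoped Kronecker in
theorem traceNorm_tensor_le (h : Z ⊆ Λ) {ρ : Op q Z} {τ : Op q (Λ \ Z)} (hρ : IsState ρ)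
    (hτ : IsState τ) : traceNorm (tensor h ρ τ) ≤ 1 := by
  have tensor_eq : tensor h ρ τ = (ρ ⊗ₖ τ).submatrix (splitConfig h) (splitConfig h) := rfl
  rw [tensor_eq, traceNorm_submatrix]
  refine (traceNorm_le_re_trace (hρ.1.kronecker hτ.1)).trans_eq ?_
  rw [Matrix.trace_kronecker, hρ.2, hτ.2, mul_one, Complex.one_re]

end Regions

/-! ### Propagation of local terms -/

section Propagation

open NormedSpace

variable {V : Type*} [DecidableEq V]

theorem sum_filter_not_disjoint_le (S : Finset (Finset V)) (Y : Finset V) {g : Finset V → ℝ}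
    (hg : ∀ Z, 0 ≤ g Z) :
    ∑ Z ∈ S with ¬Disjoint Z Y, g Z ≤ ∑ y ∈ Y, ∑ Z ∈ S with y ∈ Z, g Z := by
  simp only [Finset.sum_filter]
  rw [Finset.sum_comm]
  refine Finset.sum_le_sum fun Z _ => ?_
  have term_nonneg (y : V) (_ : y ∈ Y) : 0 ≤ if y ∈ Z then g Z else 0 :=
    ite_nonneg (hg Z) le_rfl
  split_ifs with hZY
  · exact Finset.sum_nonneg term_nonneg
  · obtain ⟨y, hyZ, hyY⟩ := Finset.not_disjoint_iff.1 hZY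
    exact (if_pos hyZ).ge.trans (Finset.single_le_sum term_nonneg hyY)

variable {E : Type*} [NormedAddCommGroup E] [NormedSpace ℝ E] {Λ Y Z : Finset V}
  {M : Finset V → E →L[ℝ] E} {L N P : E →L[ℝ] E} {x₀ : E} {n : V → ℝ} {w : Finset V → ℝ}
  {δ v β t : ℝ}

/-- The activity of the vector `x` at the site `y`: the total size of the images of `x` under the
local terms `M Z`, `Z ⊆ Λ`, whose support contains `y`. -/
def localActivity (Λ : Finset V) (M : Finset V → E →L[ℝ] E) (x : E) (y : V) : ℝ :=
  ∑ Z ∈ Λ.powerset with y ∈ Z, ‖M Z x‖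

theorem localActivity_nonneg (x : E) (y : V) : 0 ≤ localActivity Λ M x y :=
  Finset.sum_nonneg fun _ _ => norm_nonneg _

theorem continuous_localActivity (y : V) : Continuous fun x => localActivity Λ M x y := by
  unfold localActivity
  fun_prop

/-- The contraction generator `N` arises from `L` by removing all local terms whose support meets
`Y`, up to an error of norm at most `δ`. -/
structure IsRemoval (Λ : Finset V) (M : Finset V → E →L[ℝ] E) (Y : Finset V) (δ : ℝ)
    (L N : E →L[ℝ] E) : Prop where
  isContractionGenerator : IsContractionGenerator N
  norm_sub_sub_sum_le : ‖L - N - ∑ Z ∈ Λ.powerset with ¬Disjoint Z Y, M Z‖ ≤ δ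

theorem IsRemoval.norm_sub_apply_le (h : IsRemoval Λ M Y δ L N) (x : E) :
    ‖(L - N) x‖ ≤ ∑ y ∈ Y, localActivity Λ M x y + δ * ‖x‖ := by
  set T := ∑ Z ∈ Λ.powerset with ¬Disjoint Z Y, M Z
  have norm_T_le : ‖T x‖ ≤ ∑ y ∈ Y, localActivity Λ M x y := by
    rw [sum_apply]
    exact (norm_sum_le _ _).trans (sum_filter_not_disjoint_le _ Y fun Z => norm_nonneg (M Z x))
  calc
    ‖(L - N) x‖ = ‖T x + (L - N - T) x‖ := by rw [sub_apply _ T, add_sub_cancel]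
    _ ≤ _ := (norm_add_le _ _).trans
      (add_le_add norm_T_le ((L - N - T).le_of_opNorm_le h.norm_sub_sub_sum_le x))

/-- The largest weighted activity of `x` on `Λ`. -/
def weightedActivity (Λ : Finset V) (M : Finset V → E →L[ℝ] E) (n : V → ℝ) (x : E) : ℝ :=
  ‖fun y : Λ => n y * localActivity Λ M x y‖

theorem mul_localActivity_le (n : V → ℝ) {x : E} {y : V} (hy : y ∈ Λ) :
    n y * localActivity Λ M x y ≤ weightedActivity Λ M n x :=
  (le_abs_self _).trans (norm_le_pi_norm (fun y : Λ => n y * localActivity Λ M x y) ⟨y, hy⟩)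

theorem mul_sum_localActivity_add_le (hn : ∀ x, 0 < n x)
    (hnw : ∀ x ∈ Z, ∀ y ∈ Z, n x ≤ w Z * n y) (hβ : 0 ≤ β) (hZ : Z ⊆ Λ) {y z : V} (hy : y ∈ Z)
    (hz : z ∈ Z) (x : E) :
    n y * (∑ y' ∈ Z, localActivity Λ M x y' + β / n z) ≤
      Z.card * w Z * (weightedActivity Λ M n x + β) := by
  have hw : 0 ≤ w Z := nonneg_of_mul_nonneg_left ((hn y).le.trans (hnw y hy y hy)) (hn y)
  have hcard : (1 : ℝ) ≤ Z.card := by exact_mod_cast Finset.card_pos.2 ⟨y, hy⟩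
  have site_le (y' : V) (hy' : y' ∈ Z) :
      n y * localActivity Λ M x y' ≤ w Z * weightedActivity Λ M n x := calc
    n y * localActivity Λ M x y' ≤ w Z * n y' * localActivity Λ M x y' :=
      mul_le_mul_of_nonneg_right (hnw y hy y' hy') (localActivity_nonneg _ y')
    _ ≤ w Z * weightedActivity Λ M n x := by
      rw [mul_assoc]
      exact mul_le_mul_of_nonneg_left (mul_localActivity_le n (hZ hy')) hw
  have error_le : n y * (β / n z) ≤ Z.card * w Z * β := calc
    n y * (β / n z) ≤ w Z * n z * (β / n z) :=
      mul_le_mul_of_nonneg_right (hnw y hy z hz) (div_nonneg hβ (hn z).le)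
    _ = w Z * β := by rw [mul_assoc, mul_div_cancel₀ _ (hn z).ne']
    _ ≤ Z.card * w Z * β := by
      gcongr
      exact le_mul_of_one_le_left hw hcard
  calc
    _ = ∑ y' ∈ Z, n y * localActivity Λ M x y' + n y * (β / n z) := by rw [mul_add, Finset.mul_sum]
    _ ≤ Z.card * (w Z * weightedActivity Λ M n x) + Z.card * w Z * β :=
      add_le_add (by simpa using Finset.sum_le_card_nsmul Z _ _ site_le) error_le
    _ = _ := by ring

variable [CompleteSpace E]

theorem continuous_localActivity_exp_smul_apply (y : V) :
    Continuous fun s : ℝ => localActivity Λ M (exp (s • L) x₀) y :=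
  (continuous_localActivity y).comp (continuous_exp_smul_apply L x₀)

theorem IsRemoval.norm_apply_exp_sub_exp_apply_le (h : IsRemoval Λ M Y δ L N)
    (hP : Commute P N) (hL : IsContractionGenerator L) (hx₀ : ‖x₀‖ ≤ 1) (ht : 0 ≤ t) :
    ‖P (exp (t • L) x₀) - exp (t • N) (P x₀)‖ ≤
      ‖P‖ * ∫ s in (0 : ℝ)..t, (∑ y ∈ Y, localActivity Λ M (exp (s • L) x₀) y + δ) := by
  have hδ : 0 ≤ δ := (norm_nonneg _).trans h.norm_sub_sub_sum_le
  have cont (y : V) := continuous_localActivity_exp_smul_apply (Λ := Λ) (M := M) (L := L)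
    (x₀ := x₀) y
  refine (OpenLattice.norm_apply_exp_sub_exp_apply_le hP h.isContractionGenerator L x₀ ht).trans ?_
  rw [← intervalIntegral.integral_const_mul]
  refine intervalIntegral.integral_mono_on ht
    (((P * (L - N)).continuous.comp (continuous_exp_smul_apply L x₀)).norm.intervalIntegrable _ _)
    ((by fun_prop : Continuous _).intervalIntegrable _ _) fun s hs => ?_
  refine P.le_opNorm_of_le ((h.norm_sub_apply_le _).trans ?_)
  gcongr
  exact mul_le_of_le_one_right hδ ((hL.norm_exp_smul_apply_le hs.1 x₀).trans hx₀)

theorem continuous_weightedActivity_exp_smul_apply :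
    Continuous fun s : ℝ => weightedActivity Λ M n (exp (s • L) x₀) :=
  (continuous_pi fun _ => (continuous_localActivity_exp_smul_apply _).const_mul _).norm

theorem mul_norm_apply_exp_le (hn : ∀ x, 0 < n x) (hnw : ∀ x ∈ Z, ∀ y ∈ Z, n x ≤ w Z * n y)
    (hL : IsContractionGenerator L) (hx₀ : ‖x₀‖ ≤ 1) (hZ : Z ⊆ Λ) {x z : V} (hx : x ∈ Z)
    (hz : z ∈ Z) (hMx₀ : n x * ‖M Z x₀‖ ≤ ‖M Z‖ * w Z) (hβ : 0 ≤ β)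
    (hN : IsRemoval Λ M Z (β / n z) L N) (hMN : Commute (M Z) N) (ht : 0 ≤ t) :
    n x * ‖M Z (exp (t • L) x₀)‖ ≤ ‖M Z‖ * Z.card * w Z *
      (1 + ∫ s in (0 : ℝ)..t, (weightedActivity Λ M n (exp (s • L) x₀) + β)) := by
  set act := fun (s : ℝ) y => localActivity Λ M (exp (s • L) x₀) y
  set W := fun s : ℝ => weightedActivity Λ M n (exp (s • L) x₀)
  have act_cont (y : V) : Continuous fun s => act s y := continuous_localActivity_exp_smul_apply y
  have W_cont : Continuous W := continuous_weightedActivity_exp_smul_apply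
  have hw : 0 ≤ w Z := nonneg_of_mul_nonneg_left ((hn x).le.trans (hnw x hx x hx)) (hn x)
  have hcard : (1 : ℝ) ≤ Z.card := by exact_mod_cast Finset.card_pos.2 ⟨x, hx⟩
  have increment_le : n x * ∫ s in (0 : ℝ)..t, (∑ y ∈ Z, act s y + β / n z) ≤
      Z.card * w Z * ∫ s in (0 : ℝ)..t, (W s + β) := by
    rw [← intervalIntegral.integral_const_mul, ← intervalIntegral.integral_const_mul]
    exact intervalIntegral.integral_mono_on ht
      ((by fun_prop : Continuous _).intervalIntegrable _ _)
      ((by fun_prop : Continuous _).intervalIntegrable _ _) fun s _ =>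
        mul_sum_localActivity_add_le hn hnw hβ hZ hx hz _
  calc
    n x * ‖M Z (exp (t • L) x₀)‖
      ≤ n x * (‖M Z x₀‖ + ‖M Z‖ * ∫ s in (0 : ℝ)..t, (∑ y ∈ Z, act s y + β / n z)) := by
        refine mul_le_mul_of_nonneg_left ?_ (hn x).le
        refine (norm_le_norm_add_norm_sub' _ (exp (t • N) (M Z x₀))).trans ?_
        exact add_le_add (hN.isContractionGenerator.norm_exp_smul_apply_le ht _)
          (hN.norm_apply_exp_sub_exp_apply_le hMN hL hx₀ ht)
    _ = n x * ‖M Z x₀‖ + ‖M Z‖ * (n x * ∫ s in (0 : ℝ)..t, (∑ y ∈ Z, act s y + β / n z)) := by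
        ring
    _ ≤ ‖M Z‖ * w Z * Z.card + ‖M Z‖ * (Z.card * w Z * ∫ s in (0 : ℝ)..t, (W s + β)) := by
        refine add_le_add (hMx₀.trans (le_mul_of_one_le_right (by positivity) hcard)) ?_
        exact mul_le_mul_of_nonneg_left increment_le (norm_nonneg _)
    _ = _ := by ring

/-- The weighted activity satisfies a linear integral inequality, to which Grönwall applies. -/
theorem weightedActivity_exp_le (hn : ∀ x, 0 < n x)
    (hnw : ∀ Z, ∀ x ∈ Z, ∀ y ∈ Z, n x ≤ w Z * n y) (hβ : 0 ≤ β) (hv : 0 < v)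
    (hsum : ∀ x, ∑ Z ∈ Λ.powerset with x ∈ Z, ‖M Z‖ * Z.card * w Z ≤ v)
    (hL : IsContractionGenerator L) (hx₀ : ‖x₀‖ ≤ 1)
    (hMx₀ : ∀ Z ⊆ Λ, ∀ x ∈ Z, n x * ‖M Z x₀‖ ≤ ‖M Z‖ * w Z)
    (hdec : ∀ Z ⊆ Λ, Z.Nonempty → ∃ z ∈ Z, ∃ N, IsRemoval Λ M Z (β / n z) L N ∧ Commute (M Z) N)
    (ht : 0 ≤ t) :
    weightedActivity Λ M n (exp (t • L) x₀) ≤ (v + β) * Real.exp (v * t) := by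
  set W := fun s : ℝ => weightedActivity Λ M n (exp (s • L) x₀)
  have W_cont : Continuous W := continuous_weightedActivity_exp_smul_apply
  have W_nonneg (s : ℝ) : 0 ≤ W s := norm_nonneg _
  have integral_ineq (r : ℝ) (hr : 0 ≤ r) : W r ≤ v + ∫ s in (0 : ℝ)..r, (v * W s + v * β) := by
    have integral_nonneg : 0 ≤ 1 + ∫ s in (0 : ℝ)..r, (W s + β) :=
      add_nonneg zero_le_one (intervalIntegral.integral_nonneg hr fun s _ =>
        add_nonneg (W_nonneg s) hβ)
    have factor : v + ∫ s in (0 : ℝ)..r, (v * W s + v * β) =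
        v * (1 + ∫ s in (0 : ℝ)..r, (W s + β)) := by
      simp only [← mul_add, intervalIntegral.integral_const_mul, mul_one_add]
    rw [factor]
    refine (pi_norm_le_iff_of_nonneg (mul_nonneg hv.le integral_nonneg)).2 fun x => ?_
    rw [Real.norm_of_nonneg (mul_nonneg (hn x).le (localActivity_nonneg _ _)), localActivity,
      Finset.mul_sum]
    refine (Finset.sum_le_sum fun Z hZ => ?_).trans
      ((Finset.sum_mul _ _ _).ge.trans (mul_le_mul_of_nonneg_right (hsum x) integral_nonneg))
    obtain ⟨hZΛ, hx⟩ := Finset.mem_filter.1 hZ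
    have hZΛ := Finset.mem_powerset.1 hZΛ
    obtain ⟨z, hz, N, hN, hMN⟩ := hdec Z hZΛ ⟨x, hx⟩
    exact mul_norm_apply_exp_le hn (hnw Z) hL hx₀ hZΛ hx hz (hMx₀ Z hZΛ x hx) hβ hN hMN hr
  refine (le_gronwallBound_of_le_integral W_cont hv.le integral_ineq ht).trans ?_
  rw [gronwallBound_of_K_ne_0 hv.ne', mul_div_cancel_left₀ _ hv.ne', add_mul]
  linarith

theorem IsRemoval.norm_exp_sub_exp_le {n₀ : ℝ} (h : IsRemoval Λ M Y δ L N) (hn₀ : 0 < n₀)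
    (hv : 0 < v) (hL : IsContractionGenerator L) (hx₀ : ‖x₀‖ ≤ 1)
    (hact : ∀ y ∈ Y, ∀ s, 0 ≤ s →
      n₀ * localActivity Λ M (exp (s • L) x₀) y ≤ (v + β) * Real.exp (v * s))
    (ht : 0 ≤ t) :
    ‖exp (t • L) x₀ - exp (t • N) x₀‖ ≤
      Y.card * n₀⁻¹ * (1 + β / v) * (Real.exp (v * t) - 1) + δ * t := by
  have hδ : 0 ≤ δ := (norm_nonneg _).trans h.norm_sub_sub_sum_le
  have act_cont (y : V) := continuous_localActivity_exp_smul_apply (Λ := Λ) (M := M) (L := L)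
    (x₀ := x₀) y
  have act_le (s : ℝ) (hs : 0 ≤ s) : ∑ y ∈ Y, localActivity Λ M (exp (s • L) x₀) y ≤
      Y.card * n₀⁻¹ * (v + β) * Real.exp (v * s) := by
    rw [mul_assoc, mul_assoc, ← nsmul_eq_mul]
    exact Finset.sum_le_card_nsmul Y _ _ fun y hy => (le_inv_mul_iff₀ hn₀).2 (hact y hy s hs)
  calc
    _ ≤ ‖(1 : E →L[ℝ] E)‖ * ∫ s in (0 : ℝ)..t,
          (∑ y ∈ Y, localActivity Λ M (exp (s • L) x₀) y + δ) :=
        h.norm_apply_exp_sub_exp_apply_le (Commute.one_left N) hL hx₀ ht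
    _ ≤ ∫ s in (0 : ℝ)..t, (Y.card * n₀⁻¹ * (v + β) * Real.exp (v * s) + δ) := by
        refine (mul_le_of_le_one_left (intervalIntegral.integral_nonneg ht fun s _ => ?_)
          ContinuousLinearMap.norm_id_le).trans ?_
        · exact add_nonneg (Finset.sum_nonneg fun y _ => localActivity_nonneg _ y) hδ
        · exact intervalIntegral.integral_mono_on ht
            ((by fun_prop : Continuous _).intervalIntegrable _ _)
            ((by fun_prop : Continuous _).intervalIntegrable _ _) fun s hs =>
              add_le_add_left (act_le s hs.1) δ
    _ = _ := by
        have integral_exp : ∫ s in (0 : ℝ)..t, Real.exp (v * s) = v⁻¹ * (Real.exp (v * t) - 1) := by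
          simp [intervalIntegral.integral_comp_mul_left _ hv.ne']
        rw [intervalIntegral.integral_add ((by fun_prop : Continuous _).intervalIntegrable _ _)
          (by simp), intervalIntegral.integral_const_mul, integral_exp,
          intervalIntegral.integral_const, smul_eq_mul]
        field_simp
        ring

end Propagation

/-! ### The generators of a uniform family -/

section Generators

variable {D : ℕ} {q : Site D → ℕ} {A Y Z S Λ : Finset (Site D)} {ν : ℕ → ℝ} {v b c : ℝ}

namespace BoundaryTerms

variable (B : BoundaryTerms q Λ)

theorem upTo_eq_sum_range (n : ℕ) :
    B.upTo n = ∑ d ∈ Finset.range n, extend (bdry_subset (d + 1) Λ) (B.term (d + 1)) := by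
  rw [upTo, Finset.range_eq_Ico, Finset.sum_Ico_add' (fun d => extend (bdry_subset d Λ) (B.term d))]
  rfl

theorem hasSum_total_sub_upTo_apply (n : ℕ) (X : Op q Λ) :
    HasSum (fun d => extend (bdry_subset (d + n + 1) Λ) (B.term (d + n + 1)) X)
      ((B.total - B.upTo n) X) := by
  rw [LinearMap.sub_apply, upTo_eq_sum_range, LinearMap.sum_apply]
  exact (hasSum_nat_add_iff' n).2 (B.summable X).hasSum

theorem norm_total_sub_upTo_le {n : ℕ}
    (h : ∑' d : {d : ℕ // 1 ≤ d ∧ n + 1 ≤ d}, diamondNorm (B.term d) ≠ ∞) :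
    ‖superCLM (B.total - B.upTo n)‖ ≤
      (∑' d : {d : ℕ // 1 ≤ d ∧ n + 1 ≤ d}, diamondNorm (B.term d)).toReal := by
  let shift : ℕ → {d : ℕ // 1 ≤ d ∧ n + 1 ≤ d} := fun d => ⟨d + n + 1, by omega, by omega⟩
  have shift_injective : Function.Injective shift := fun d d' hd => by
    simpa [shift] using hd
  have tail_le : ∑' d, diamondNorm (B.term (shift d)) ≤
      ∑' d : {d : ℕ // 1 ≤ d ∧ n + 1 ≤ d}, diamondNorm (B.term d) :=
    ENNReal.tsum_comp_le_tsum_of_injective shift_injective fun d => diamondNorm (B.term d)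
  have tail_ne_top := ne_top_of_le_ne_top h tail_le
  refine norm_superCLM_le ENNReal.toReal_nonneg fun X => ?_
  have series := (B.hasSum_total_sub_upTo_apply n X).map toTraceClass
    toTraceClass.toContinuousLinearEquiv.continuous
  calc
    traceNorm ((B.total - B.upTo n) X)
      ≤ (∑' d, diamondNorm (B.term (shift d))).toReal * traceNorm X := by
        rw [← norm_toTraceClass, ← series.tsum_eq,
          ENNReal.tsum_toReal_eq (ENNReal.ne_top_of_tsum_ne_top tail_ne_top)]
        exact tsum_of_norm_bounded ((ENNReal.hasSum_toReal tail_ne_top).mul_right _) fun d =>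
          traceNorm_extend_le _ (ENNReal.ne_top_of_tsum_ne_top tail_ne_top d) X
    _ ≤ _ := mul_le_mul_of_nonneg_right (ENNReal.toReal_mono h tail_le) (traceNorm_nonneg X)

end BoundaryTerms

namespace UniformFamily

variable (F : UniformFamily q)

/-- The bulk term of `Z` as a superoperator of `Λ`, zero unless `Z ⊆ Λ`. -/
def localTerm (Λ Z : Finset (Site D)) : SuperOp q Λ :=
  if h : Z ⊆ Λ then extend h (F.M Z) else 0

variable {F}

theorem localTerm_of_subset (h : Z ⊆ Λ) : F.localTerm Λ Z = extend h (F.M Z) := dif_pos h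

theorem bulk_eq_sum (h : S ⊆ Λ) : F.bulk h = ∑ Z ∈ S.powerset, F.localTerm Λ Z := by
  rw [← Finset.sum_coe_sort]
  exact Finset.sum_congr rfl fun Z _ =>
    (localTerm_of_subset ((Finset.mem_powerset.1 Z.2).trans h)).symm

theorem isLindbladian_localTerm : IsLindbladian (F.localTerm Λ Z) := by
  rw [localTerm]
  split_ifs with h
  · exact (F.isLindbladian_M Z).extend h
  · exact IsLindbladian.zero

theorem isLindbladian_closed : IsLindbladian (F.closed Λ) := by
  rw [closed, bulk_eq_sum]
  exact (IsLindbladian.sum fun _ _ => isLindbladian_localTerm).add (F.isLindbladian_B Λ)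

theorem isLindbladian_removed {k : ℕ} : IsLindbladian (F.removed Λ S k) := by
  rw [removed, bulk_eq_sum]
  exact (IsLindbladian.sum fun _ _ => isLindbladian_localTerm).add (F.isLindbladian_upTo Λ k)

theorem removed_eq_sum {k : ℕ} :
    F.removed Λ Y k = ∑ Z ∈ Λ.powerset with Disjoint Z Y, F.localTerm Λ Z + (F.B Λ).upTo k := by
  rw [removed, bulk_eq_sum]
  congr 2
  ext Z
  simp [Finset.subset_sdiff]

theorem closed_sub_removed_sub_sum {k : ℕ} :
    F.closed Λ - F.removed Λ Y k - ∑ Z ∈ Λ.powerset with ¬Disjoint Z Y, F.localTerm Λ Z =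
      (F.B Λ).total - (F.B Λ).upTo k := by
  rw [closed, bulk_eq_sum, removed_eq_sum,
    ← Finset.sum_filter_add_sum_filter_not Λ.powerset (Disjoint · Y)]
  abel

theorem commute_localTerm (h : Disjoint Y Z) : Commute (F.localTerm Λ Y) (F.localTerm Λ Z) := by
  rw [localTerm, localTerm]
  split_ifs
  · exact extend_commute _ _ h _ _
  all_goals simp

theorem commute_localTerm_removed {k : ℕ} (h : ∀ d ∈ Finset.Icc 1 k, Disjoint Z (bdry d Λ)) :
    Commute (F.localTerm Λ Z) (F.removed Λ Z k) := by
  rw [removed_eq_sum]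
  refine (Commute.sum_right _ _ _ fun Y hY =>
    commute_localTerm (Finset.mem_filter.1 hY).2.symm).add_right
    (Commute.sum_right _ _ _ fun d hd => ?_)
  rw [localTerm]
  split_ifs
  · exact extend_commute _ _ (h d hd) _ _
  · exact Commute.zero_left _

theorem norm_localTerm_le (h : diamondNorm (F.M Z) ≠ ∞) :
    ‖superCLM (F.localTerm Λ Z)‖ ≤ (diamondNorm (F.M Z)).toReal := by
  refine norm_superCLM_le ENNReal.toReal_nonneg fun X => ?_
  rw [localTerm]
  split_ifs
  · exact traceNorm_extend_le _ h X
  · rw [LinearMap.zero_apply, traceNorm_zero]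
    exact mul_nonneg ENNReal.toReal_nonneg (traceNorm_nonneg X)

theorem LiebRobinson.sum_diamondNorm_le (hF : F.LiebRobinson ν v b c) (Λ : Finset (Site D))
    (x : Site D) :
    ∑ Z ∈ Λ.powerset with x ∈ Z,
      diamondNorm (F.M Z) * (Z.card : ℝ≥0∞) * ENNReal.ofReal (ν (gdiam Z)) ≤ ENNReal.ofReal v := by
  rw [← Finset.sum_subtype_eq_sum_filter]
  exact (ENNReal.sum_le_tsum _).trans (hF.bulk_decay x)

theorem LiebRobinson.diamondNorm_ne_top (hF : F.LiebRobinson ν v b c) (hZ : Z.Nonempty) :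
    diamondNorm (F.M Z) ≠ ∞ := by
  obtain ⟨x, hx⟩ := hZ
  intro htop
  have card_ne_zero : (Z.card : ℝ≥0∞) ≠ 0 := by exact_mod_cast (Finset.card_pos.2 ⟨x, hx⟩).ne'
  have weight_ne_zero : ENNReal.ofReal (ν (gdiam Z)) ≠ 0 := by simpa using hF.ν_pos (gdiam Z)
  have term_le := (ENNReal.le_tsum (⟨Z, hx⟩ : {Z : Finset (Site D) // x ∈ Z})).trans
    (hF.bulk_decay x)
  rw [htop, ENNReal.top_mul card_ne_zero, ENNReal.top_mul weight_ne_zero] at term_le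
  exact ENNReal.ofReal_ne_top (top_le_iff.1 term_le)

theorem LiebRobinson.sum_norm_localTerm_le (hF : F.LiebRobinson ν v b c) (Λ : Finset (Site D))
    (x : Site D) :
    ∑ Z ∈ Λ.powerset with x ∈ Z, ‖superCLM (F.localTerm Λ Z)‖ * Z.card * ν (gdiam Z) ≤ v := by
  have diamondNorm_ne_top {Z : Finset (Site D)} (hZ : Z ∈ Λ.powerset.filter (x ∈ ·)) :
      diamondNorm (F.M Z) ≠ ∞ := hF.diamondNorm_ne_top ⟨x, (Finset.mem_filter.1 hZ).2⟩
  calc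
    _ ≤ ∑ Z ∈ Λ.powerset with x ∈ Z,
          (diamondNorm (F.M Z) * (Z.card : ℝ≥0∞) * ENNReal.ofReal (ν (gdiam Z))).toReal := by
        refine Finset.sum_le_sum fun Z hZ => ?_
        have weight_nonneg := (hF.ν_pos (gdiam Z)).le
        rw [ENNReal.toReal_mul, ENNReal.toReal_mul, ENNReal.toReal_natCast,
          ENNReal.toReal_ofReal weight_nonneg]
        gcongr
        exact norm_localTerm_le (diamondNorm_ne_top hZ)
    _ ≤ v := by
        rw [← ENNReal.toReal_sum fun Z hZ => ENNReal.mul_ne_top (ENNReal.mul_ne_top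
          (diamondNorm_ne_top hZ) (ENNReal.natCast_ne_top _)) ENNReal.ofReal_ne_top]
        exact ENNReal.toReal_le_of_le_ofReal hF.v_pos.le (hF.sum_diamondNorm_le Λ x)

theorem BoundaryDecay.norm_total_sub_upTo_le (hν : ∀ r, 0 < ν r) (hν_mono : Monotone ν)
    (hc : 0 ≤ c) (h : F.BoundaryDecay ν b c A) {N : ℕ} (hN : 1 ≤ N) (n : ℕ) :
    ‖superCLM ((F.B (nbhd A N)).total - (F.B (nbhd A N)).upTo n)‖ ≤ c * (N : ℝ) ^ b / ν n := by
  set tail := ∑' d : {d : ℕ // 1 ≤ d ∧ n + 1 ≤ d}, diamondNorm ((F.B (nbhd A N)).term d)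
  have decay : ENNReal.ofReal (ν (n + 1)) * tail ≤ ENNReal.ofReal (c * (N : ℝ) ^ b) := h N hN _
  have tail_ne_top : tail ≠ ∞ := fun htop => by
    rw [htop, ENNReal.mul_top (by simpa using hν (n + 1))] at decay
    exact ENNReal.ofReal_ne_top (top_le_iff.1 decay)
  have real_decay : ν (n + 1) * tail.toReal ≤ c * (N : ℝ) ^ b := by
    simpa [(hν _).le] using ENNReal.toReal_le_of_le_ofReal (by positivity) decay
  rw [le_div_iff₀' (hν n)]
  calc
    _ ≤ ν (n + 1) * tail.toReal := mul_le_mul (hν_mono n.le_succ)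
        ((F.B (nbhd A N)).norm_total_sub_upTo_le tail_ne_top) (norm_nonneg _) (hν _).le
    _ ≤ _ := real_decay

theorem BoundaryDecay.isRemoval (hν : ∀ r, 0 < ν r) (hν_mono : Monotone ν) (hc : 0 ≤ c)
    (h : F.BoundaryDecay ν b c A) {N : ℕ} (hN : 1 ≤ N) (Y : Finset (Site D)) (k : ℕ) :
    IsRemoval (nbhd A N) (fun Z => superCLM (F.localTerm (nbhd A N) Z)) Y (c * (N : ℝ) ^ b / ν k)
      (superCLM (F.closed (nbhd A N))) (superCLM (F.removed (nbhd A N) Y k)) where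
  isContractionGenerator := isLindbladian_removed.isContractionGenerator
  norm_sub_sub_sum_le := by
    rw [← map_sum, ← map_sub, ← map_sub, closed_sub_removed_sub_sum]
    exact h.norm_total_sub_upTo_le hν hν_mono hc hN k

end UniformFamily

end Generators

/-! ### Depth inside a neighbourhood -/

section Depth

variable {D : ℕ} {A Z : Finset (Site D)} {m : ℕ} {x y : Site D}

theorem gdist_le_gdiam (hx : x ∈ Z) (hy : y ∈ Z) : gdist x y ≤ gdiam Z :=
  (Finset.le_sup (f := gdist x) hy).trans (Finset.le_sup (f := fun x => Z.sup (gdist x)) hx)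

/-- The depth `m - dist(x, A)` of a site inside the neighbourhood `A(m)`; it is zero outside, by
truncated subtraction. -/
def depth (A : Finset (Site D)) (m : ℕ) (x : Site D) : ℕ := A.sup fun a => m - gdist a x

theorem depth_eq_of_mem (hx : x ∈ A) : depth A m x = m := by
  refine le_antisymm (Finset.sup_le fun _ _ => Nat.sub_le _ _) ?_
  have self_le : m ≤ m - gdist x x := by simp [gdist]
  exact self_le.trans (Finset.le_sup (f := fun a => m - gdist a x) hx)

theorem depth_eq_zero (hx : x ∉ nbhd A m) : depth A m x = 0 := by
  refine Nat.eq_zero_of_le_zero (Finset.sup_le fun a ha => ?_)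
  have far : ¬gdist a x ≤ m := fun h => hx (mem_nbhd.2 ⟨a, ha, h⟩)
  omega

theorem depth_le_gdist_add (x y : Site D) : depth A m x ≤ gdist x y + depth A m y := by
  refine Finset.sup_le fun a ha => ?_
  have le_depth : m - gdist a y ≤ depth A m y := Finset.le_sup (f := fun a => m - gdist a y) ha
  have triangle := gdist_triangle a x y
  omega

theorem depth_le_gdiam_add (hx : x ∈ Z) (hy : y ∈ Z) :
    depth A m x ≤ gdiam Z + depth A m y :=
  (depth_le_gdist_add x y).trans (Nat.add_le_add_right (gdist_le_gdiam hx hy) _)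

theorem depth_lt_of_mem_bdry {d : ℕ} (hd : 1 ≤ d) (hx : x ∈ bdry d (nbhd A (m + 1))) :
    depth A m x < d := by
  classical
  obtain ⟨-, y, hy, hxy⟩ := Finset.mem_filter.1 hx
  refine (Finset.sup_lt_iff hd).2 fun a ha => ?_
  have far : ¬gdist a y ≤ m + 1 := fun h => hy (mem_nbhd.2 ⟨a, ha, h⟩)
  have triangle := gdist_triangle a x y
  omega

end Depth

/-! ### Propagation from a fixed point -/

section FixedPoint

variable {D : ℕ} {q : Site D → ℕ} {A : Finset (Site D)} {F : UniformFamily q} {ν : ℕ → ℝ}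
  {v b c : ℝ} {m : ℕ} {ρ : Op q (nbhd A m)} {τ : Op q (nbhd A (m + 1) \ nbhd A m)}

namespace UniformFamily

theorem LiebRobinson.ν_depth_le (hF : F.LiebRobinson ν v b c) {Z : Finset (Site D)} {x y : Site D}
    (hx : x ∈ Z) (hy : y ∈ Z) : ν (depth A m x) ≤ ν (gdiam Z) * ν (depth A m y) :=
  (hF.ν_mono (depth_le_gdiam_add hx hy)).trans (hF.ν_mul _ _)

/-- At the site `z` of `Z` closest to the boundary, `Z` misses the boundary terms up to depth
`depth A m z`, and the remaining boundary terms are small. -/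
theorem LiebRobinson.exists_isRemoval_commute (hF : F.LiebRobinson ν v b c)
    (hA : F.BoundaryDecay ν b c A) {Z : Finset (Site D)} (hZ : Z.Nonempty) :
    ∃ z ∈ Z, ∃ N, IsRemoval (nbhd A (m + 1))
      (fun Z => superCLM (F.localTerm (nbhd A (m + 1)) Z)) Z
      (c * ((m + 1 : ℕ) : ℝ) ^ b / ν (depth A m z)) (superCLM (F.closed (nbhd A (m + 1)))) N ∧
      Commute (superCLM (F.localTerm (nbhd A (m + 1)) Z)) N := by
  obtain ⟨z, hz, hz_min⟩ := Z.exists_min_image (depth A m) hZ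
  refine ⟨z, hz, _, hA.isRemoval hF.ν_pos hF.ν_mono hF.c_pos.le m.succ_pos Z (depth A m z),
    (commute_localTerm_removed fun d hd => Finset.disjoint_left.2 fun x hx hxd => ?_).map superCLM⟩
  obtain ⟨hd1, hdz⟩ := Finset.mem_Icc.1 hd
  exact (depth_lt_of_mem_bdry hd1 hxd).not_ge (hdz.trans (hz_min x hx))

theorem FrustrationFree.localTerm_tensor_eq_zero (hFF : F.FrustrationFree)
    {Z Y Λ : Finset (Site D)} {ρ : Op q Y} (hρ : F.IsFixedPoint Y ρ) (hZ : Z ⊆ Y) (h : Y ⊆ Λ)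
    (τ : Op q (Λ \ Y)) : F.localTerm Λ Z (tensor h ρ τ) = 0 := by
  rw [localTerm_of_subset (hZ.trans h), extend_tensor h hZ, hFF Y ρ hρ Z hZ]
  ext σ σ'
  simp [tensor]

/-- Local terms inside `A(m)` annihilate the initial state; all others have depth at most their
diameter. -/
theorem FrustrationFree.ν_depth_mul_norm_localTerm_tensor_le (hFF : F.FrustrationFree)
    (hF : F.LiebRobinson ν v b c) (hρ : F.IsFixedPoint (nbhd A m) ρ) (hτ : IsState τ)
    {Z : Finset (Site D)} {x : Site D} (hx : x ∈ Z) :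
    ν (depth A m x) * ‖superCLM (F.localTerm (nbhd A (m + 1)) Z)
        (toTraceClass (tensor (nbhd_mono A m.le_succ) ρ τ))‖ ≤
      ‖superCLM (F.localTerm (nbhd A (m + 1)) Z)‖ * ν (gdiam Z) := by
  have ν_nonneg (r : ℕ) : 0 ≤ ν r := (hF.ν_pos r).le
  by_cases hZ : Z ⊆ nbhd A m
  · rw [superCLM_toTraceClass, hFF.localTerm_tensor_eq_zero hρ hZ, map_zero, norm_zero, mul_zero]
    exact mul_nonneg (norm_nonneg _) (ν_nonneg _)
  · obtain ⟨y, hy, hyA⟩ := Finset.not_subset.1 hZ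
    have depth_le : depth A m x ≤ gdiam Z := by
      simpa [depth_eq_zero hyA] using depth_le_gdiam_add (A := A) (m := m) hx hy
    have norm_le := (superCLM (F.localTerm (nbhd A (m + 1)) Z)).le_of_opNorm_le_of_le le_rfl
      (traceNorm_tensor_le (nbhd_mono A m.le_succ) hρ.1 hτ)
    rw [mul_comm]
    exact mul_le_mul (norm_le.trans_eq (mul_one _)) (hF.ν_mono depth_le) (ν_nonneg _)
      (norm_nonneg _)

theorem FrustrationFree.ν_mul_localActivity_le (hFF : F.FrustrationFree)
    (hF : F.LiebRobinson ν v b c) (hA : F.BoundaryDecay ν b c A)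
    (hρ : F.IsFixedPoint (nbhd A m) ρ) (hτ : IsState τ) {x : Site D} (hx : x ∈ A) {t : ℝ}
    (ht : 0 ≤ t) :
    ν m * localActivity (nbhd A (m + 1)) (fun Z => superCLM (F.localTerm (nbhd A (m + 1)) Z))
        (NormedSpace.exp (t • superCLM (F.closed (nbhd A (m + 1))))
          (toTraceClass (tensor (nbhd_mono A m.le_succ) ρ τ))) x ≤
      (v + c * ((m + 1 : ℕ) : ℝ) ^ b) * Real.exp (v * t) := by
  have hc := hF.c_pos
  have hxB : x ∈ nbhd A (m + 1) := mem_nbhd.2 ⟨x, hx, by simp [gdist]⟩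
  have weighted := weightedActivity_exp_le
    (n := fun x => ν (depth A m x)) (w := fun Z => ν (gdiam Z))
    (fun x => hF.ν_pos _) (fun Z x hx y hy => hF.ν_depth_le hx hy)
    (by positivity : 0 ≤ c * ((m + 1 : ℕ) : ℝ) ^ b) hF.v_pos (hF.sum_norm_localTerm_le _)
    isLindbladian_closed.isContractionGenerator
    (traceNorm_tensor_le (nbhd_mono A m.le_succ) hρ.1 hτ)
    (fun Z _ x hx => hFF.ν_depth_mul_norm_localTerm_tensor_le hF hρ hτ hx)
    (fun Z _ hZ => hF.exists_isRemoval_commute hA hZ) ht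
  have at_x := (mul_localActivity_le (fun x => ν (depth A m x)) hxB).trans weighted
  rwa [depth_eq_of_mem hx] at at_x

theorem FrustrationFree.traceNorm_evolve_closed_sub_evolve_removed_le (hFF : F.FrustrationFree)
    (hF : F.LiebRobinson ν v b c) (hA : F.BoundaryDecay ν b c A)
    (hρ : F.IsFixedPoint (nbhd A m) ρ) (hτ : IsState τ) {t : ℝ} (ht : 0 ≤ t) :
    traceNorm
        (evolve (F.closed (nbhd A (m + 1))) t (tensor (nbhd_mono A m.le_succ) ρ τ) -
          evolve (F.removed (nbhd A (m + 1)) A (m + 1)) t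
            (tensor (nbhd_mono A m.le_succ) ρ τ)) ≤
      A.card * (ν m)⁻¹ * (1 + c * ((m + 1 : ℕ) : ℝ) ^ b / v) * (Real.exp (v * t) - 1) +
        c * ((m + 1 : ℕ) : ℝ) ^ b / ν m * t := by
  have hc := hF.c_pos
  rw [← norm_toTraceClass, map_sub, toTraceClass_evolve, toTraceClass_evolve]
  refine ((hA.isRemoval hF.ν_pos hF.ν_mono hc.le m.succ_pos A (m + 1)).norm_exp_sub_exp_le
    (hF.ν_pos m) hF.v_pos isLindbladian_closed.isContractionGenerator
    (traceNorm_tensor_le (nbhd_mono A m.le_succ) hρ.1 hτ)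
    (fun x hx s hs => hFF.ν_mul_localActivity_le hF hA hρ hτ hx hs) ht).trans ?_
  gcongr
  · exact hF.ν_pos m
  · exact hF.ν_mono m.le_succ

end UniformFamily

end FixedPoint

theorem exists_polynomial_forall_mul_rpow_le (b c : ℝ) :
    ∃ Q : Polynomial ℝ, ∀ m : ℕ, c * ((m + 1 : ℕ) : ℝ) ^ b ≤ Q.eval (m : ℝ) := by
  refine ⟨Polynomial.C |c| * (Polynomial.X + 1) ^ ⌈b⌉₊, fun m => ?_⟩
  rw [Polynomial.eval_mul, Polynomial.eval_pow, Polynomial.eval_add, Polynomial.eval_C,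
    Polynomial.eval_X, Polynomial.eval_one, ← Nat.cast_add_one, ← Real.rpow_natCast]
  exact mul_le_mul (le_abs_self c)
    (Real.rpow_le_rpow_of_exponent_le (by simp) (Nat.le_ceil b)) (by positivity) (abs_nonneg c)

end OpenLattice

end

theorem mainTheorem6 {D : ℕ} (A : Finset (Site D)) (v b c : ℝ) :
    ∃ P : Polynomial ℝ,
      ∀ (q : Site D → ℕ) (F : UniformFamily q) (ν : ℕ → ℝ),
        F.FrustrationFree → F.LiebRobinson ν v b c → F.BoundaryDecay ν b c A →
        ∀ m : ℕ, 1 ≤ m →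
        ∀ (ρ : Op q (nbhd A m)) (τ : Op q (nbhd A (m + 1) \ nbhd A m)),
          F.IsFixedPoint (nbhd A m) ρ → IsState τ →
          ∀ t : ℝ, 0 ≤ t →
            traceNorm
                (evolve (F.closed (nbhd A (m + 1))) t
                    (tensor (nbhd_mono A (Nat.le_succ m)) ρ τ) -
                  evolve (F.removed (nbhd A (m + 1)) A (m + 1)) t
                    (tensor (nbhd_mono A (Nat.le_succ m)) ρ τ)) ≤
              P.eval (m : ℝ) * (ν m)⁻¹ * (Real.exp (v * t) - 1 + t) := by
  obtain ⟨Q, hQ⟩ := exists_polynomial_forall_mul_rpow_le b c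
  refine ⟨Polynomial.C (A.card : ℝ) * (1 + Polynomial.C v⁻¹ * Q) + Q, ?_⟩
  intro q F ν hFF hF hA m _ ρ τ hρ hτ t ht
  have hv := hF.v_pos
  have hc := hF.c_pos
  have hν := hF.ν_pos m
  have exp_sub_one_nonneg : 0 ≤ Real.exp (v * t) - 1 :=
    sub_nonneg.2 (Real.one_le_exp (by positivity))
  have Q_nonneg : 0 ≤ Q.eval (m : ℝ) := le_trans (by positivity) (hQ m)
  calc
    _ ≤ A.card * (ν m)⁻¹ * (1 + c * ((m + 1 : ℕ) : ℝ) ^ b / v) * (Real.exp (v * t) - 1) +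
          c * ((m + 1 : ℕ) : ℝ) ^ b / ν m * t :=
        hFF.traceNorm_evolve_closed_sub_evolve_removed_le hF hA hρ hτ ht
    _ ≤ A.card * (ν m)⁻¹ * (1 + Q.eval (m : ℝ) / v) * (Real.exp (v * t) - 1 + t) +
          Q.eval (m : ℝ) / ν m * (Real.exp (v * t) - 1 + t) := by
        gcongr <;> first | exact hQ m | linarith
    _ = _ := by
        simp only [Polynomial.eval_add, Polynomial.eval_mul, Polynomial.eval_C, Polynomial.eval_one]
        ring
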